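/- Setting. Let $d\ge 2$, $p,p_0\ge1$. For a $d$-tuple $\mathbf\Xi=(\Xi_1,\dots,\Xi_d)$ of $p$-open knot vectors on $[0,1]$ (interior multiplicities at most $p$), let $S_p(\mathbf\Xi)$ be the tensor-product spline space of degree $p$ in each direction, and let $\hat{\mathcal M}_0$ be its parametric Bézier mesh (the open boxes $Q$ between consecutive breakpoints). Let $\mathbf F:(0,1)^d\to\Omega_0=\mathbf F((0,1)^d)\subset\mathbb R^d$ be a bi-Lipschitz map with components in $S_{p_0}(\mathbf\Xi^0)$ for fixed $p_0$-open knot vectors $\mathbf\Xi^0$, and fix constants $\sigma>0$, $\theta\in(0,1]$, $c_N>0$, $c_\Gamma>0$. Consider any $\mathbf\Xi$ with $S_{p_0}(\mathbf\Xi^0)\subseteq S_p(\mathbf\Xi)$ that is shape-regular with constant $\sigma$ ($\operatorname{diam}Q\le\sigma\cdot$ each edge length of $Q$, for all $Q\in\hat{\mathcal M}_0$); any bounded open set $\Omega_1\subset\mathbb R^d$ such that $\Omega=\Omega_0\setminus\overline{\Omega_1}$ has Lipschitz boundary; and any measurable $\Gamma_D\subseteq\partial\Omega$. Let $\mathbf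 n$ be the outward unit normal of $\Omega$, $\Gamma_{trim}=\partial\Omega\cap\partial\Omega_1$, $\hat\Omega=\mathbf F^{-1}(\Omega)$, and $V_h=\{\hat v\circ\mathbf F^{-1}:\hat v\in S_p(\mathbf\Xi)\}$, $\tilde V_h=\{v|_\Omega: v\in V_h\}$. Let $\mathcal M_h$ be the set of elements $K=\mathbf F(Q)$ with $Q\in\hat{\mathcal M}_0$, $Q\cap\hat\Omega\neq\emptyset$, and put $h_K=\operatorname{diam}K$, $\Gamma_K=\Gamma_D\cap\overline K$, $\mathcal G_h=\{K\in\mathcal M_h:\overline K\cap\Gamma_{trim}\ne\emptyset\}$. An element $K=\mathbf F(Q)\in\mathcal M_h$ is good if $|\hat\Omega\cap Q|\ge\theta|Q|$, and bad otherwise. Its set of neighbors is $\mathcal N(K)=\{K'\in\mathcal M_h:\operatorname{dist}(K,K')\le c_N h_K\}\setminus\{K\}$. Assume that the $(d-1)$-dimensional measure satisfies $|\Gamma_K|\le c_\Gamma h_K^{d-1}$ for all $K\in\mathcal M_h$, and that every bad element has a good neighbor. Put $K'=K$ if $K$ is good, and for each bad $K$ let $K'\in\mathcal N(K)$ be any chosen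 good neighbor. Stabilization in the physical domain. Every $v_h\in\tilde V_h$ has a unique extension to each $K\in\mathcal M_h$ by functions of $V_h$; denote it again by $v_h$. For $K\in\mathcal G_h$, $R_h(v_h)$ on $\Gamma_K$ is $$R_K(v_h)=\begin{cases}\dfrac{\partial (v_h|_K)}{\partial n}&\text{if } K\text{ is good},\\[2mm] \dfrac{\partial\,\mathcal E\big(P(v_h|_{K'})\big)}{\partial n}&\text{if } K\text{ is bad},\end{cases}$$ where, in the first case, the gradient of $v_h|_K$ is extended continuously to $\overline K$, $P:L^2(K')\to\mathbb Q_p(K')$ is the $L^2(K')$-orthogonal projection onto the polynomials of degree at most $p$ in each coordinate, and $\mathcal E$ is the natural extension of a polynomial from $K'$ to $\mathbb R^d$. Theorem. There is a constant $C>0$, depending only on $d,p,p_0,\mathbf\Xi^0,\mathbf F,\sigma,\theta,c_N,c_\Gamma$ (and thus not on $\mathbf\Xi$, $\Omega_1$, $\Gamma_D$ or the choice of good neighbors), such that in every such configuration and for every $K\in\mathcal G_h$: $R_K(v_h)$ depends only on $v_h\in\tilde V_h$ and lies in $L^2(\Gamma_K)$, and $$\big\| h_K^{1/2}R_h(v_h)\big\|_{L^2(\Gamma_K)}\le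 C\,\|\nabla v_h\|_{L^2(\Omega\cap K')}\qquad\forall\, v_h\in\tilde V_h .$$ -/

import Mathlib

open MeasureTheory Topology Set
open scoped Gradient ENNReal RealInnerProductSpace

namespace TrimmedIGA

/-! ### Univariate and tensor-product splines -/

/-- A `p`-open knot vector on `[0,1]` with `n + p + 1` knots, numbered from `0`:
`0 = ξ 0 = ⋯ = ξ p < ξ (p+1) ≤ ⋯ ≤ ξ (n-1) < ξ n = ⋯ = ξ (n+p) = 1`, where every
internal knot is repeated at most `p` times.  Only the indices up to `n + p` matter. -/
structure KnotVector (p : ℕ) where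
  /-- number of basis functions -/
  n : ℕ
  /-- the knots -/
  ξ : ℕ → ℝ
  mono : ∀ i, i < n + p → ξ i ≤ ξ (i + 1)
  first : ∀ i, i ≤ p → ξ i = 0
  first_lt : ξ p < ξ (p + 1)
  last_lt : ξ (n - 1) < ξ n
  last : ∀ i, n ≤ i → i ≤ n + p → ξ i = 1
  mult_le : ∀ i, i < n → 0 < ξ i → ξ i < 1 → ξ i < ξ (i + p)

/-- The B-spline of degree `q` on the knots `ξ i, …, ξ (i+q+1)`, by the Cox–de Boor recursion
with the convention `0 / 0 = 0` (only its values on the open interval `(0,1)` are used). -/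
noncomputable def bspline (ξ : ℕ → ℝ) : ℕ → ℕ → ℝ → ℝ
  | 0, i, x => if ξ i ≤ x ∧ x < ξ (i + 1) then 1 else 0
  | q + 1, i, x =>
      (x - ξ i) / (ξ (i + q + 1) - ξ i) * bspline ξ q i x
        + (ξ (i + q + 2) - x) / (ξ (i + q + 2) - ξ (i + 1)) * bspline ξ q (i + 1) x

/-- `ℝ^d` with its Euclidean structure. -/
abbrev E (d : ℕ) : Type := EuclideanSpace ℝ (Fin d)

variable {d p : ℕ}

/-- The tensor-product B-spline with multi-index `i`. -/
noncomputable def tensorBspline (Ξ : Fin d → KnotVector p) (i : Fin d → ℕ) (x : E d) : ℝ :=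
  ∏ l, bspline (Ξ l).ξ p (i l) (x l)

/-- The multivariate spline space `S_p(Ξ)`. -/
noncomputable def splineSpace (Ξ : Fin d → KnotVector p) : Submodule ℝ (E d → ℝ) :=
  Submodule.span ℝ {f | ∃ i : Fin d → ℕ, (∀ l, i l < (Ξ l).n) ∧ f = tensorBspline Ξ i}

/-! ### Parametrization and meshes

Elements of the physical mesh are the images `F '' Q`; they are indexed by the parametric
elements `Q`. -/

/-- The parametric domain `(0,1)^d`. -/
def cube (d : ℕ) : Set (E d) := {x | ∀ l, x l ∈ Ioo (0 : ℝ) 1}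

/-- The open knot cell with lower corner index `j`. -/
def cell (Ξ : Fin d → KnotVector p) (j : Fin d → ℕ) : Set (E d) :=
  {x | ∀ l, x l ∈ Ioo ((Ξ l).ξ (j l)) ((Ξ l).ξ (j l + 1))}

/-- `j` indexes a nonempty knot cell, that is, a product of intervals between consecutive
breakpoints. -/
def IsCellIndex (Ξ : Fin d → KnotVector p) (j : Fin d → ℕ) : Prop :=
  ∀ l, j l < (Ξ l).n ∧ (Ξ l).ξ (j l) < (Ξ l).ξ (j l + 1)

/-- The parametric Bézier mesh. -/
def paramMesh (Ξ : Fin d → KnotVector p) : Set (Set (E d)) :=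
  {Q | ∃ j, IsCellIndex Ξ j ∧ Q = cell Ξ j}

/-- Shape regularity with constant `σ`: the diameter of every Bézier element is at most `σ` times
each of its edges. -/
def ShapeRegular (σ : ℝ) (Ξ : Fin d → KnotVector p) : Prop :=
  ∀ j, IsCellIndex Ξ j →
    ∀ l, Metric.diam (cell Ξ j) ≤ σ * ((Ξ l).ξ (j l + 1) - (Ξ l).ξ (j l))

/-- `F` is a spline map on the parametric domain: each component agrees there with an element
of `S_p(Ξ)`. -/
def IsSplineMap (Ξ : Fin d → KnotVector p) (F : E d → E d) : Prop :=
  ∀ i, ∃ s ∈ splineSpace Ξ, ∀ x ∈ cube d, F x i = s x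

/-- `F` is bi-Lipschitz on the set `A`. -/
def IsBiLipschitzOn (F : E d → E d) (A : Set (E d)) : Prop :=
  ∃ a b : ℝ, 0 < a ∧ ∀ x ∈ A, ∀ y ∈ A,
    a * dist x y ≤ dist (F x) (F y) ∧ dist (F x) (F y) ≤ b * dist x y

/-- The space `V_h` of the functions `s ∘ F⁻¹` on `F((0,1)^d)` with `s` in `S_p(Ξ)`, written as
functions on `ℝ^d` of which only the values on `F((0,1)^d)` are used.  Its restriction to the
trimmed domain is the discrete space on the trimmed domain. -/
noncomputable def physSpace (F : E d → E d) (Ξ : Fin d → KnotVector p) : Set (E d → ℝ) :=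
  {v | ∃ s ∈ splineSpace Ξ, v = fun x => s (Function.invFunOn F (cube d) x)}

/-- The trimmed physical domain `Ω = F((0,1)^d) \ closure Ω₁`. -/
def trimmedDomain (F : E d → E d) (Ω₁ : Set (E d)) : Set (E d) := (F '' cube d) \ closure Ω₁

/-- The preimage of the trimmed domain in the parametric domain. -/
def paramDomain (F : E d → E d) (Ω : Set (E d)) : Set (E d) := cube d ∩ F ⁻¹' Ω

/-- The elements that meet the trimmed domain. -/
def activeMesh (F : E d → E d) (Ξ : Fin d → KnotVector p) (Ω : Set (E d)) : Set (Set (E d)) :=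
  {Q ∈ paramMesh Ξ | (Q ∩ paramDomain F Ω).Nonempty}

/-- The active elements whose closed image meets the trimming curve `∂Ω ∩ ∂Ω₁`. -/
def cutMesh (F : E d → E d) (Ξ : Fin d → KnotVector p) (Ω Ω₁ : Set (E d)) : Set (Set (E d)) :=
  {Q ∈ activeMesh F Ξ Ω | (closure (F '' Q) ∩ (frontier Ω ∩ frontier Ω₁)).Nonempty}

/-- `h_K`, the diameter of `K = F(Q)`. -/
noncomputable def hK (F : E d → E d) (Q : Set (E d)) : ℝ := Metric.diam (F '' Q)

/-- Good elements: at least the fraction `θ` of `Q` lies in the trimmed parametric domain. -/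
def IsGood (θ : ℝ) (F : E d → E d) (Ω Q : Set (E d)) : Prop :=
  θ ≤ volume.real (paramDomain F Ω ∩ Q) / volume.real Q

/-- The distance of two sets. -/
noncomputable def setDist (A B : Set (E d)) : ℝ := sInf (image2 dist A B)

/-- The good neighbors of `K = F(Q)`: good active elements `K' = F(Q')` different from `K` with
`dist(K, K') ≤ c * h_K`. -/
def goodNeighbors (θ c : ℝ) (F : E d → E d) (Ξ : Fin d → KnotVector p) (Ω Q : Set (E d)) :
    Set (Set (E d)) :=
  {Q' ∈ activeMesh F Ξ Ω |
    Q' ≠ Q ∧ setDist (F '' Q) (F '' Q') ≤ c * hK F Q ∧ IsGood θ F Ω Q'}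

/-! ### Lipschitz domains, normals -/

/-- `Ω` has a Lipschitz boundary: near each boundary point, in suitable orthonormal coordinates,
`Ω` is the region below the graph of a Lipschitz function of the remaining coordinates. -/
def HasLipschitzBoundary (Ω : Set (E d)) : Prop :=
  ∀ x ∈ frontier Ω, ∃ r > 0, ∃ e : E d, ‖e‖ = 1 ∧ ∃ (c : NNReal) (g : E d → ℝ),
    LipschitzWith c g ∧
      ∀ y ∈ Metric.ball x r, y ∈ Ω ↔ ⟪e, y⟫ < g (y - ⟪e, y⟫ • e)

/-- `ν` is an outward unit normal of `Ω` at `x`: near `x`, and up to cones of arbitrarily small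
opening around the hyperplane orthogonal to `ν`, the set `Ω` is the half-space that `ν` points
out of.  There is at most one such `ν`, and it is the usual normal wherever a local graph
representation of `Ω` is differentiable, hence almost everywhere on a Lipschitz boundary. -/
def IsOutwardNormal (Ω : Set (E d)) (x ν : E d) : Prop :=
  ‖ν‖ = 1 ∧ ∀ ε > 0, ∃ r > 0, ∀ y ∈ Metric.ball x r,
    (⟪y - x, ν⟫ < -(ε * ‖y - x‖) → y ∈ Ω) ∧ (ε * ‖y - x‖ < ⟪y - x, ν⟫ → y ∉ Ω)

open Classical in
/-- The outward unit normal field of `Ω` (set to `0` where there is none). -/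
noncomputable def outwardNormal (Ω : Set (E d)) (x : E d) : E d :=
  if h : ∃ ν, IsOutwardNormal Ω x ν then h.choose else 0

/-! ### The stabilization operator in the physical domain -/

/-- The function on `ℝ^d` of a polynomial. -/
noncomputable def polyFun (q : MvPolynomial (Fin d) ℝ) (x : E d) : ℝ :=
  MvPolynomial.eval (fun i => x i) q

/-- `q` is the `L²(K)`-orthogonal projection of `v` onto the polynomials `ℚ_p` of degree at most
`p` in each coordinate. -/
def IsL2Projection (p : ℕ) (K : Set (E d)) (v : E d → ℝ) (q : MvPolynomial (Fin d) ℝ) : Prop :=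
  q ∈ MvPolynomial.restrictDegree (Fin d) ℝ p ∧
    ∀ r ∈ MvPolynomial.restrictDegree (Fin d) ℝ p,
      ∫ x in K, (v x - polyFun q x) * polyFun r x = 0

/-- The `L²(K)`-orthogonal projection onto `ℚ_p`, as a polynomial.  Read as a function on all of
`ℝ^d`, it is the natural extension of the projection. -/
noncomputable def l2Projection (p : ℕ) (K : Set (E d)) (v : E d → ℝ) : MvPolynomial (Fin d) ℝ :=
  Classical.epsilon (IsL2Projection p K v)

open Classical in
/-- `K'`: the element itself if it is good, the chosen good neighbor otherwise. -/
noncomputable def supportElement (θ : ℝ) (F : E d → E d) (Ω : Set (E d))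
    (nb : Set (E d) → Set (E d)) (Q : Set (E d)) : Set (E d) :=
  if IsGood θ F Ω Q then Q else nb Q

open Classical in
/-- `R_K(v)` on the part of the boundary in the closure of `K = F(Q)`.  On a good element it is
the normal derivative of `v|_K`, the gradient of `v|_K` being extended continuously to the closure
of `K`; on a bad element it is the normal derivative of the polynomial extension of the
`L²`-projection of `v` on the chosen good neighbor `F(nb Q)`. -/
noncomputable def stabilization (p : ℕ) (θ : ℝ) (F : E d → E d) (Ω : Set (E d))
    (nb : Set (E d) → Set (E d)) (Q : Set (E d)) (v : E d → ℝ) (x : E d) : ℝ :=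
  if IsGood θ F Ω Q then
    ⟪extendFrom (F '' Q) (∇ v) x, outwardNormal Ω x⟫
  else
    ⟪∇ (polyFun (l2Projection p (F '' nb Q) v)) x, outwardNormal Ω x⟫

/-- `Γ_K`, the part of the Dirichlet boundary in the closure of `K = F(Q)`. -/
def boundaryPart (F : E d → E d) (ΓD Q : Set (E d)) : Set (E d) := ΓD ∩ closure (F '' Q)

/-- The surface measure, that is, the `(d-1)`-dimensional Hausdorff measure normalized so that it
agrees with Lebesgue measure on hyperplanes. -/
noncomputable def surfaceMeasure (d : ℕ) : Measure (E d) :=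
  Measure.euclideanHausdorffMeasure (d - 1)

end TrimmedIGA

/-! Let K' = F(Q') be the good support element, H = diam Q', and q the polynomial that the spline
equals on Q'. Every estimate passes through one number M, a bound for |∇q| on the ball of radius H
about a point of Q'. It suffices to show that M H^(d/2) ≤ C ‖∇v‖ in L²(Ω ∩ K') and that |R_K(v)| ≤ C
M on Γ_K. Then h_K |Γ_K| (C M)² ≤ C h_K^d M², and h_K ≤ C H finishes the proof
(`memLp_and_eLpNorm_le`).

The tool for both bounds is a Remez inequality, `exists_remez`: a polynomial of bounded degree can
be much smaller than its value and scaled gradient at a given point only on a set of small measure.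
It follows from compactness of the unit sphere of coefficients, because a nonzero polynomial
vanishes only on a null set (`eq_zero_of_polyFun_eq_zero`).

First bound (`exists_gradient_bound`): goodness and shape regularity give the trimmed part of Q' a
measure of at least θ (H/σ)^d, so each partial derivative of q at any point of the ball is
controlled on a sizable subset of it. The bi-Lipschitz map carries this to the physical gradient.

Second bound: on a good element the extended gradient is Dq composed with an inverse Jacobian of
norm at most 1/a. On a bad element v oscillates by at most M H on K', hence so does its L²
projection in the mean-square sense, and a second use of Remez bounds the gradient of the projection
on a larger ball that also contains Γ_K (`exists_projection_bound`). The radius of that ball is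
comparable to H because for d ≥ 2 shape regularity of a tensor-product mesh forces quasi-uniformity
(`ShapeRegular.diam_le`).

Of the normal only measurability (`measurable_outwardNormal`) and length at most one are used. That
R_K depends only on v in Ω holds because a polynomial is determined by its values on a set of
positive measure (`eqOn_of_eqOn_trimmed`). -/

namespace TrimmedIGA

/-! ### Polynomial functions -/

section Polynomials

variable {d : ℕ}

lemma hasFDerivAt_polyFun (q : MvPolynomial (Fin d) ℝ) (x : E d) :
    HasFDerivAt (polyFun q)
      (∑ i, polyFun (MvPolynomial.pderiv i q) x • (EuclideanSpace.proj i : E d →L[ℝ] ℝ)) x := by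
  induction q using MvPolynomial.induction_on with
  | C a =>
    have h : polyFun (MvPolynomial.C a : MvPolynomial (Fin d) ℝ) = fun _ => a := by
      ext y; simp [polyFun]
    rw [h]
    exact (hasFDerivAt_const a x).congr_fderiv (by simp [polyFun])
  | add p q hp hq =>
    have h : polyFun (p + q) = fun y => polyFun p y + polyFun q y := by
      ext y; simp [polyFun]
    rw [h]
    exact (hp.add hq).congr_fderiv (by simp [polyFun, add_smul, Finset.sum_add_distrib])
  | mul_X p i hp =>
    have h : polyFun (p * MvPolynomial.X i) =
        fun y => polyFun p y * (EuclideanSpace.proj i : E d →L[ℝ] ℝ) y := by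
      ext y; simp [polyFun]
    rw [h]
    refine (hp.mul (EuclideanSpace.proj i : E d →L[ℝ] ℝ).hasFDerivAt).congr_fderiv ?_
    simp only [Derivation.leibniz, MvPolynomial.pderiv_X, smul_eq_mul, polyFun, map_add, map_mul,
      MvPolynomial.eval_X, add_smul, Finset.sum_add_distrib, Finset.smul_sum, smul_smul]
    congr 1
    rw [Finset.sum_eq_single i]
    · simp
    · intro j _ hj
      simp [hj.symm]
    · simp

lemma contDiff_polyFun (q : MvPolynomial (Fin d) ℝ) {n : WithTop ℕ∞} :
    ContDiff ℝ n (polyFun q) := by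
  induction q using MvPolynomial.induction_on with
  | C a =>
    have h : polyFun (MvPolynomial.C a : MvPolynomial (Fin d) ℝ) = fun _ => a := by
      ext y; simp [polyFun]
    rw [h]
    exact contDiff_const
  | add p q hp hq =>
    have h : polyFun (p + q) = fun y => polyFun p y + polyFun q y := by
      ext y; simp [polyFun]
    rw [h]
    exact hp.add hq
  | mul_X p i hp =>
    have h : polyFun (p * MvPolynomial.X i) =
        fun y => polyFun p y * (EuclideanSpace.proj i : E d →L[ℝ] ℝ) y := by
      ext y; simp [polyFun]
    rw [h]
    exact hp.mul (EuclideanSpace.proj i : E d →L[ℝ] ℝ).contDiff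

lemma continuous_polyFun (q : MvPolynomial (Fin d) ℝ) : Continuous (polyFun q) :=
  (contDiff_polyFun q (n := 0)).continuous

lemma gradient_polyFun_apply (q : MvPolynomial (Fin d) ℝ) (x : E d) (i : Fin d) :
    (∇ (polyFun q) x) i = polyFun (MvPolynomial.pderiv i q) x := by
  have h1 : ⟪∇ (polyFun q) x, EuclideanSpace.single i (1 : ℝ)⟫ =
      fderiv ℝ (polyFun q) x (EuclideanSpace.single i 1) :=
    InnerProductSpace.toDual_symm_apply
  rw [(hasFDerivAt_polyFun q x).fderiv, EuclideanSpace.inner_single_right] at h1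
  simpa [Pi.single_apply] using h1

lemma norm_gradient_eq {f : E d → ℝ} {x : E d} : ‖∇ f x‖ = ‖fderiv ℝ f x‖ := by
  simp [gradient]

lemma continuous_gradient_polyFun (q : MvPolynomial (Fin d) ℝ) : Continuous (∇ (polyFun q)) :=
  (InnerProductSpace.toDual ℝ (E d)).symm.continuous.comp
    ((contDiff_polyFun q (n := 1)).continuous_fderiv one_ne_zero)

lemma pderiv_mem_restrictTotalDegree {N : ℕ} {q : MvPolynomial (Fin d) ℝ}
    (hq : q ∈ MvPolynomial.restrictTotalDegree (Fin d) ℝ N) (i : Fin d) :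
    MvPolynomial.pderiv i q ∈ MvPolynomial.restrictTotalDegree (Fin d) ℝ (N - 1) := by
  have key : MvPolynomial.restrictTotalDegree (Fin d) ℝ N ≤
      (MvPolynomial.restrictTotalDegree (Fin d) ℝ (N - 1)).comap
        ((MvPolynomial.pderiv i).toLinearMap) := by
    rw [MvPolynomial.restrictTotalDegree, MvPolynomial.restrictSupport_eq_span, Submodule.span_le]
    rintro _ ⟨m, hm, rfl⟩
    simp only [Submodule.comap_coe, mem_preimage, Derivation.coeFn_coe,
      MvPolynomial.pderiv_monomial, SetLike.mem_coe, MvPolynomial.restrictTotalDegree,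
      MvPolynomial.monomial_mem_restrictSupport, mem_ofPred_eq]
    by_cases h0 : m i = 0
    · right; simp [h0]
    · left
      have h1 : Finsupp.single i 1 ≤ m := by
        simpa using Nat.one_le_iff_ne_zero.mpr h0
      have h2 : (m - Finsupp.single i 1).degree + (Finsupp.single i 1).degree = m.degree := by
        rw [← map_add, tsub_add_cancel_of_le h1]
      have h3 : m.degree ≤ N := hm
      have h4 : (m - Finsupp.single i 1).degree ≤ N - 1 := by
        rw [Finsupp.degree_single] at h2; omega
      exact h4
  exact key hq

/-- Rescaling does not leave the finite-dimensional space of polynomials, so the Remez inequality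
needs its compactness argument on one fixed ball only. -/
lemma exists_polyFun_affine {N : ℕ} {q : MvPolynomial (Fin d) ℝ}
    (hq : q ∈ MvPolynomial.restrictTotalDegree (Fin d) ℝ N) (z : E d) (r : ℝ) :
    ∃ q' ∈ MvPolynomial.restrictTotalDegree (Fin d) ℝ N,
      ∀ u, polyFun q' u = polyFun q (z + r • u) := by
  let g : Fin d → MvPolynomial (Fin d) ℝ := fun i =>
    MvPolynomial.C (z i) + MvPolynomial.C r * MvPolynomial.X i
  have hg : ∀ i, (g i).totalDegree ≤ 1 := fun i => by
    refine (MvPolynomial.totalDegree_add _ _).trans (max_le (by simp) ?_)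
    refine (MvPolynomial.totalDegree_mul _ _).trans (by simp)
  refine ⟨MvPolynomial.aeval g q, ?_, fun u => ?_⟩
  · have key : MvPolynomial.restrictTotalDegree (Fin d) ℝ N ≤
        (MvPolynomial.restrictTotalDegree (Fin d) ℝ N).comap
          ((MvPolynomial.aeval g).toLinearMap) := by
      conv_lhs =>
        rw [MvPolynomial.restrictTotalDegree, MvPolynomial.restrictSupport_eq_span]
      rw [Submodule.span_le]
      rintro _ ⟨m, hm, rfl⟩
      simp only [Submodule.comap_coe, mem_preimage, AlgHom.toLinearMap_apply, SetLike.mem_coe,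
        MvPolynomial.mem_restrictTotalDegree, MvPolynomial.aeval_monomial, map_one, one_mul]
      refine (MvPolynomial.totalDegree_finsetProd _ _).trans ?_
      refine le_trans (Finset.sum_le_sum fun i _ => ?_) (show (m.sum fun _ e => e) ≤ N from hm)
      refine (MvPolynomial.totalDegree_pow _ _).trans ?_
      simpa using Nat.mul_le_mul_left (m i) (hg i)
    exact key hq
  · simp only [polyFun, MvPolynomial.aeval_def]
    rw [← MvPolynomial.coe_eval₂Hom, ← RingHom.comp_apply]
    congr 1
    apply MvPolynomial.ringHom_ext
    · intro a; simp
    · intro i; simp [g]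

lemma restrictDegree_le_restrictTotalDegree (p : ℕ) :
    MvPolynomial.restrictDegree (Fin d) ℝ p ≤
      MvPolynomial.restrictTotalDegree (Fin d) ℝ (d * p) := by
  apply MvPolynomial.restrictSupport_mono
  intro n hn
  have h : n.degree ≤ d * p := by
    rw [Finsupp.degree_eq_sum]
    exact (Finset.sum_le_card_nsmul _ _ p fun i _ => hn i).trans (by simp)
  exact h

/-- A polynomial that vanishes on a set of positive measure is zero. -/
lemma eq_zero_of_polyFun_eq_zero {q : MvPolynomial (Fin d) ℝ} {s : Set (E d)}
    (hs : volume s ≠ 0) (h : ∀ x ∈ s, polyFun q x = 0) : q = 0 := by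
  have key : ∀ N : ℕ, ∀ q ∈ MvPolynomial.restrictTotalDegree (Fin d) ℝ N,
      volume {x : E d | polyFun q x = 0} ≠ 0 → q = 0 := by
    intro N
    induction N with
    | zero =>
      intro q hq h0
      rw [MvPolynomial.mem_restrictTotalDegree, Nat.le_zero,
        MvPolynomial.totalDegree_eq_zero_iff_eq_C] at hq
      obtain ⟨x, hx⟩ := nonempty_of_measure_ne_zero h0
      rw [hq] at hx ⊢
      simpa [polyFun] using hx
    | succ N ih =>
      intro q hq h0
      set Z : Set (E d) := {x : E d | polyFun q x = 0} with hZ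
      have hZm : MeasurableSet Z :=
        (isClosed_singleton.preimage (continuous_polyFun q)).measurableSet
      -- The partial derivatives have lower degree and vanish almost everywhere on `Z`, so the
      -- induction hypothesis makes them zero and `q` constant.
      have hpd : ∀ i, MvPolynomial.pderiv i q = 0 := by
        intro i
        apply ih _ (by simpa using pderiv_mem_restrictTotalDegree hq i)
        -- a.e. on `Z` the derivative vanishes
        have happ : ApproximatesLinearOn
            (fun x : E d => polyFun q x • EuclideanSpace.single i (1 : ℝ))
            (0 : E d →L[ℝ] E d) Z 0 := by
          intro x hx y hy
          simp only [hZ, mem_ofPred_eq] at hx hy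
          simp [hx, hy]
        -- This density-point bound concerns self-maps of ℝ^d, hence the factor e_i on the scalar
        -- polynomial. The map is zero on `Z`, so the error constant 0 gives a zero derivative
        -- almost everywhere there.
        have hae := happ.norm_fderiv_sub_le volume hZm
          (fun x => (∑ j, polyFun (MvPolynomial.pderiv j q) x •
            (EuclideanSpace.proj j : E d →L[ℝ] ℝ)).smulRight (EuclideanSpace.single i (1 : ℝ)))
          (fun x _ => ((hasFDerivAt_polyFun q x).smul_const _).hasFDerivWithinAt)
        rw [ae_restrict_iff' hZm] at hae
        intro h1
        apply h0
        have h2 : ∀ᵐ x : E d, ¬ polyFun (MvPolynomial.pderiv i q) x = 0 := by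
          rw [ae_iff]; simpa using h1
        have h3 : ∀ᵐ x : E d, x ∉ Z := by
          filter_upwards [hae, h2] with x hx1 hx2 hxZ
          have h4 := hx1 hxZ
          simp only [sub_zero, nonpos_iff_eq_zero, nnnorm_eq_zero] at h4
          have h5 := congrArg (fun L : E d →L[ℝ] E d => L (EuclideanSpace.single i 1) i) h4
          apply hx2
          simpa [Pi.single_apply] using h5
        simpa [ae_iff] using h3
      obtain ⟨x0, hx0⟩ := nonempty_of_measure_ne_zero h0
      have hconst : ∀ x, polyFun q x = 0 := by
        intro x
        rw [← show polyFun q x0 = 0 from hx0]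
        refine is_const_of_fderiv_eq_zero (𝕜 := ℝ)
          (fun x => (hasFDerivAt_polyFun q x).differentiableAt) (fun x => ?_) x x0
        rw [(hasFDerivAt_polyFun q x).fderiv]
        simp [hpd, polyFun]
      apply MvPolynomial.funext
      intro x
      simpa [polyFun] using hconst (WithLp.toLp 2 x)
  refine key q.totalDegree q (by simp [MvPolynomial.mem_restrictTotalDegree]) fun h0 => hs ?_
  exact measure_mono_null h h0

end Polynomials

/-! ### A Remez-type inequality -/

section Remez

open scoped Pointwise

variable {d : ℕ}

lemma polyFun_smul_sum {ι : Type*} [Fintype ι] (b : ι → MvPolynomial (Fin d) ℝ) (c : ι → ℝ)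
    (x : E d) : polyFun (∑ i, c i • b i) x = ∑ i, c i * polyFun (b i) x := by
  simp [polyFun]

/-- The sublevel sets of polynomials in the unit sphere of a space with basis `b` are
uniformly small. -/
lemma exists_small_sublevel {ι : Type*} [Fintype ι] {b : ι → MvPolynomial (Fin d) ℝ}
    (hb : LinearIndependent ℝ b) (R η : ℝ) (hη : 0 < η) :
    ∃ κ > 0, ∀ c : ι → ℝ, ‖c‖ = 1 →
      volume.real {u ∈ Metric.closedBall (0 : E d) R | |polyFun (∑ i, c i • b i) u| < κ} ≤ η := by
  set f : (ι → ℝ) → E d → ℝ := fun c => polyFun (∑ i, c i • b i) with hf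
  have hfin : volume (Metric.closedBall (0 : E d) R) ≠ ⊤ := measure_closedBall_lt_top.ne
  have hfc : Continuous fun t : (ι → ℝ) × E d => f t.1 t.2 := by
    simp only [hf, polyFun_smul_sum]
    refine continuous_finsetSum _ fun i _ => ?_
    exact ((continuous_apply i).comp continuous_fst).mul
      ((continuous_polyFun _).comp continuous_snd)
  suffices h : ∃ κ > 0, ∀ c ∈ Metric.sphere (0 : ι → ℝ) 1,
      volume.real {u ∈ Metric.closedBall (0 : E d) R | |f c u| < κ} ≤ η by
    obtain ⟨κ, hκ, h⟩ := h
    exact ⟨κ, hκ, fun c hc => h c (by simpa using hc)⟩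
  -- Having a common κ passes to subsets and, with the minimum, to unions of two sets of
  -- coefficients; by compactness a κ valid near each coefficient vector is enough.
  refine (isCompact_sphere (0 : ι → ℝ) 1).induction_on
    (p := fun s => ∃ κ > 0, ∀ c ∈ s,
      volume.real {u ∈ Metric.closedBall (0 : E d) R | |f c u| < κ} ≤ η)
    ⟨1, one_pos, by simp⟩ ?_ ?_ ?_
  · rintro s t hst ⟨κ, hκ, h⟩
    exact ⟨κ, hκ, fun c hc => h c (hst hc)⟩
  · rintro s t ⟨κ, hκ, h⟩ ⟨κ', hκ', h'⟩
    have hle : ∀ (c : ι → ℝ) (k : ℝ), min κ κ' ≤ k →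
        volume.real {u ∈ Metric.closedBall (0 : E d) R | |f c u| < min κ κ'} ≤
        volume.real {u ∈ Metric.closedBall (0 : E d) R | |f c u| < k} := fun c k hk =>
      measureReal_mono (fun u hu => ⟨hu.1, hu.2.trans_le hk⟩)
        (measure_ne_top_of_subset (sep_subset _ _) hfin)
    refine ⟨min κ κ', lt_min hκ hκ', ?_⟩
    rintro c (hc | hc)
    · exact (hle c κ (min_le_left _ _)).trans (h c hc)
    · exact (hle c κ' (min_le_right _ _)).trans (h' c hc)
  · intro c hc
    have hc0 : (∑ i, c i • b i) ≠ 0 := by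
      intro h0
      have := Fintype.linearIndependent_iff.mp hb c h0
      have hc1 : c = 0 := funext this
      simp [hc1] at hc
    -- a small sublevel set at `c`
    have hlim : Filter.Tendsto (fun n : ℕ =>
        volume {u ∈ Metric.closedBall (0 : E d) R | |f c u| < 1 / ((n : ℝ) + 1)}) Filter.atTop
        (𝓝 0) := by
      -- The intersection lies in the zero set of a nonzero polynomial.
      have hz : volume (⋂ n : ℕ,
          {u ∈ Metric.closedBall (0 : E d) R | |f c u| < 1 / ((n : ℝ) + 1)}) = 0 := by
        by_contra hne
        refine hc0 (eq_zero_of_polyFun_eq_zero hne fun u hu => ?_)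
        rw [mem_iInter] at hu
        have h1 : ∀ n : ℕ, |f c u| ≤ 1 / ((n : ℝ) + 1) := fun n => (hu n).2.le
        have h2 := ge_of_tendsto' tendsto_one_div_add_atTop_nhds_zero_nat h1
        exact abs_nonpos_iff.mp h2
      rw [← hz]
      refine tendsto_measure_iInter_atTop (fun n => ?_) ?_
        ⟨0, measure_ne_top_of_subset (sep_subset _ _) hfin⟩
      · refine (Metric.isClosed_closedBall.measurableSet.inter
          (IsOpen.measurableSet ?_)).nullMeasurableSet
        exact isOpen_lt (hfc.comp (Continuous.prodMk_right c)).abs continuous_const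
      · intro m n hmn u hu
        refine ⟨hu.1, hu.2.trans_le ?_⟩
        gcongr
    obtain ⟨n, hn⟩ := (hlim.eventually_le_const (ENNReal.ofReal_pos.mpr hη)).exists
    set δ : ℝ := 1 / ((n : ℝ) + 1) with hδ
    have hδ0 : 0 < δ := by positivity
    -- uniform closeness for nearby coefficients
    have hnear : ∀ᶠ c' in 𝓝 c, ∀ u ∈ Metric.closedBall (0 : E d) R, |f c' u - f c u| < δ / 2 := by
      refine (isCompact_closedBall (0 : E d) R).eventually_forall_of_forall_eventually fun u _ => ?_
      have hcont : Continuous fun t : (ι → ℝ) × E d => |f t.1 t.2 - f c t.2| :=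
        (hfc.sub (hfc.comp (continuous_const.prodMk continuous_snd))).abs
      exact (hcont.tendsto (c, u)).eventually (gt_mem_nhds (by simpa using hδ0))
    refine ⟨_, mem_nhdsWithin_of_mem_nhds hnear, δ / 2, half_pos hδ0, fun c' hc' => ?_⟩
    refine ENNReal.toReal_le_of_le_ofReal hη.le (le_trans (measure_mono ?_) hn)
    intro u hu
    refine ⟨hu.1, ?_⟩
    have h1 := hc' u hu.1
    have h2 := hu.2
    have h3 : |f c u| ≤ |f c' u| + |f c' u - f c u| := by
      have := abs_sub_abs_le_abs_sub (f c u) (f c' u)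
      rw [abs_sub_comm] at this
      linarith
    linarith

/-- Outside a set of small measure, a polynomial of bounded degree is not much smaller than its
values and derivatives at any other point. -/
lemma exists_remez_ball (d N : ℕ) (R η : ℝ) (hη : 0 < η) :
    ∃ κ > 0, ∀ q ∈ MvPolynomial.restrictTotalDegree (Fin d) ℝ N,
      ∀ y ∈ Metric.closedBall (0 : E d) R,
      volume.real {u ∈ Metric.closedBall (0 : E d) R |
        |polyFun q u| < κ * (|polyFun q y| + ‖fderiv ℝ (polyFun q) y‖)} ≤ η := by
  let B := Module.finBasis ℝ (MvPolynomial.restrictTotalDegree (Fin d) ℝ N)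
  set b : _ → MvPolynomial (Fin d) ℝ := fun i => (B i : MvPolynomial (Fin d) ℝ) with hbdef
  have hb : LinearIndependent ℝ b :=
    B.linearIndependent.map' (Submodule.subtype _) (Submodule.ker_subtype _)
  obtain ⟨κ, hκ, hsub⟩ := exists_small_sublevel hb R η hη
  have hbound : ∀ i, ∃ M : ℝ, ∀ y ∈ Metric.closedBall (0 : E d) R,
      |polyFun (b i) y| + ‖fderiv ℝ (polyFun (b i)) y‖ ≤ M := fun i => by
    have hc : Continuous fun y => |polyFun (b i) y| + ‖fderiv ℝ (polyFun (b i)) y‖ :=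
      (continuous_polyFun _).abs.add
        ((contDiff_polyFun (b i) (n := 1)).continuous_fderiv one_ne_zero).norm
    obtain ⟨M, hM⟩ := (isCompact_closedBall (0 : E d) R).bddAbove_image hc.continuousOn
    exact ⟨M, fun y hy => hM (mem_image_of_mem _ hy)⟩
  choose M hM using hbound
  set S : ℝ := ∑ i, |M i| with hS
  have hS0 : 0 ≤ S := Finset.sum_nonneg fun i _ => abs_nonneg _
  -- `S` bounds value plus derivative on the ball by the coefficient norm, so a value below this
  -- multiple puts the normalized polynomial below κ; the added 1 only keeps the denominator
  -- positive.
  refine ⟨κ / (S + 1), by positivity, fun q hq y hy => ?_⟩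
  set c : _ → ℝ := B.equivFun ⟨q, hq⟩ with hc
  have hqc : q = ∑ i, c i • b i := by
    have h1 : ((∑ i, c i • B i : MvPolynomial.restrictTotalDegree (Fin d) ℝ N) :
        MvPolynomial (Fin d) ℝ) = q := congrArg Subtype.val (B.sum_equivFun ⟨q, hq⟩)
    rw [← h1]
    simp only [Submodule.coe_sum, Submodule.coe_smul, hbdef]
  -- values and derivatives are bounded by the coefficients
  have hval : |polyFun q y| + ‖fderiv ℝ (polyFun q) y‖ ≤ S * ‖c‖ := by
    have hder : fderiv ℝ (polyFun q) y = ∑ i, c i • fderiv ℝ (polyFun (b i)) y := by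
      have h1 : polyFun q = fun x => ∑ i, c i * polyFun (b i) x := by
        ext x; rw [hqc, polyFun_smul_sum]
      rw [h1]
      refine HasFDerivAt.fderiv ?_
      refine HasFDerivAt.fun_sum fun i _ => ?_
      exact (((contDiff_polyFun (b i) (n := 1)).differentiable one_ne_zero) y).hasFDerivAt.const_mul
        (c i)
    have hv : polyFun q y = ∑ i, c i * polyFun (b i) y := by
      conv_lhs => rw [hqc]
      rw [polyFun_smul_sum]
    rw [hder, hv, hS, Finset.sum_mul]
    refine (add_le_add (Finset.abs_sum_le_sum_abs _ _) (norm_sum_le _ _)).trans ?_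
    rw [← Finset.sum_add_distrib]
    refine Finset.sum_le_sum fun i _ => ?_
    rw [abs_mul, norm_smul, Real.norm_eq_abs, ← mul_add, mul_comm]
    refine mul_le_mul ((hM i y hy).trans (le_abs_self _)) (norm_le_pi_norm c i) (abs_nonneg _)
      (abs_nonneg _)
  rcases eq_or_ne c 0 with h0 | h0
  · have h1 : {u ∈ Metric.closedBall (0 : E d) R |
        |polyFun q u| < κ / (S + 1) * (|polyFun q y| + ‖fderiv ℝ (polyFun q) y‖)} = ∅ := by
      ext u
      simp only [mem_sep_iff, mem_empty_iff_false, iff_false, not_and, not_lt]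
      intro _
      rw [h0, norm_zero, mul_zero] at hval
      exact (mul_nonpos_of_nonneg_of_nonpos (by positivity) hval).trans (abs_nonneg _)
    rw [h1]; simpa using hη.le
  · have hcn : 0 < ‖c‖ := norm_pos_iff.mpr h0
    refine le_trans (measureReal_mono ?_ (measure_ne_top_of_subset (sep_subset _ _)
      measure_closedBall_lt_top.ne)) (hsub (‖c‖⁻¹ • c) (by
        rw [norm_smul, norm_inv, norm_norm, inv_mul_cancel₀ hcn.ne']))
    rintro u ⟨hu1, hu2⟩
    refine ⟨hu1, ?_⟩
    have h3 : polyFun (∑ i, (‖c‖⁻¹ • c) i • b i) u = ‖c‖⁻¹ * polyFun q u := by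
      conv_rhs => rw [hqc]
      rw [polyFun_smul_sum, polyFun_smul_sum, Finset.mul_sum]
      simp [mul_assoc]
    rw [h3, abs_mul, abs_of_pos (inv_pos.mpr hcn), inv_mul_lt_iff₀ hcn]
    refine hu2.trans_le ?_
    rw [div_mul_eq_mul_div, div_le_iff₀ (by positivity)]
    calc κ * (|polyFun q y| + ‖fderiv ℝ (polyFun q) y‖) ≤ κ * (S * ‖c‖) := by gcongr
      _ ≤ ‖c‖ * κ * (S + 1) := by nlinarith [mul_pos hκ hcn]

/-- Remez inequality on balls of arbitrary size. -/
lemma exists_remez (d N : ℕ) (R η : ℝ) (hη : 0 < η) :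
    ∃ κ > 0, ∀ q ∈ MvPolynomial.restrictTotalDegree (Fin d) ℝ N, ∀ (z : E d) (r : ℝ), 0 < r →
      ∀ y ∈ Metric.closedBall z (R * r), ∀ A ⊆ Metric.closedBall z (R * r), MeasurableSet A →
      η * r ^ d ≤ volume.real A →
      ∃ S ⊆ A, MeasurableSet S ∧ η / 2 * r ^ d ≤ volume.real S ∧
        ∀ x ∈ S, κ * (|polyFun q y| + r * ‖∇ (polyFun q) y‖) ≤ |polyFun q x| := by
  -- With η/2 here, the rescaled exceptional set takes at most half of the guaranteed measure of
  -- `A`.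
  obtain ⟨κ, hκ, hrem⟩ := exists_remez_ball d N R (η / 2) (half_pos hη)
  refine ⟨κ, hκ, fun q hq z r hr y hy A hA hAm hAv => ?_⟩
  obtain ⟨q', hq', hqq⟩ := exists_polyFun_affine hq z r
  have hfun : polyFun q' = fun u => polyFun q (z + r • u) := funext hqq
  set w : E d := r⁻¹ • (y - z) with hw
  have hzw : z + r • w = y := by rw [hw, smul_inv_smul₀ hr.ne']; abel
  have hmem : ∀ x ∈ Metric.closedBall z (R * r),
      r⁻¹ • (x - z) ∈ Metric.closedBall (0 : E d) R := fun x hx => by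
    rw [mem_closedBall_zero_iff, norm_smul, norm_inv, Real.norm_of_nonneg hr.le,
      inv_mul_le_iff₀ hr, mul_comm r]
    simpa [dist_eq_norm] using hx
  have hder : ‖fderiv ℝ (polyFun q') w‖ = r * ‖∇ (polyFun q) y‖ := by
    have h1 : HasFDerivAt (polyFun q') (r • fderiv ℝ (polyFun q) y) w := by
      rw [hfun]
      have h2 : HasFDerivAt (fun u : E d => z + r • u) (r • ContinuousLinearMap.id ℝ (E d)) w :=
        ((hasFDerivAt_id w).const_smul r).const_add z
      have h3 : HasFDerivAt (polyFun q) (fderiv ℝ (polyFun q) y) (z + r • w) := by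
        rw [hzw]
        exact (((contDiff_polyFun q (n := 1)).differentiable one_ne_zero) y).hasFDerivAt
      refine (h3.comp w h2).congr_fderiv ?_
      ext v; simp
    rw [h1.fderiv, norm_smul, Real.norm_of_nonneg hr.le, norm_gradient_eq]
  have hb := hrem q' hq' w (hmem y hy)
  rw [hder, hqq w, hzw] at hb
  set T := |polyFun q y| + r * ‖∇ (polyFun q) y‖ with hT
  set bad : Set (E d) := {u ∈ Metric.closedBall (0 : E d) R | |polyFun q' u| < κ * T} with hbad
  set S : Set (E d) := A ∩ {x | κ * T ≤ |polyFun q x|} with hS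
  have hAS : A \ S ⊆ (fun x => z + x) '' (r • bad) := by
    rintro x ⟨hxA, hxS⟩
    refine ⟨x - z, ?_, by simp⟩
    rw [mem_smul_set_iff_inv_smul_mem₀ hr.ne']
    refine ⟨hmem x (hA hxA), ?_⟩
    rw [hqq, smul_inv_smul₀ hr.ne', add_sub_cancel]
    by_contra h
    exact hxS ⟨hxA, not_lt.mp h⟩
  have hfinbad : volume ((fun x => z + x) '' (r • bad)) = ENNReal.ofReal (r ^ d) * volume bad := by
    rw [image_add_left, measure_preimage_add, Measure.addHaar_smul]
    simp [abs_of_pos hr]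
  have hbadfin : volume bad ≠ ⊤ :=
    measure_ne_top_of_subset (sep_subset _ _) measure_closedBall_lt_top.ne
  have hAfin : volume A ≠ ⊤ := measure_ne_top_of_subset hA measure_closedBall_lt_top.ne
  have hdiff : volume.real (A \ S) ≤ η / 2 * r ^ d := by
    refine (measureReal_mono hAS (by rw [hfinbad]; exact ENNReal.mul_ne_top (by simp) hbadfin)).trans ?_
    rw [measureReal_def, hfinbad, ENNReal.toReal_mul, ENNReal.toReal_ofReal (by positivity), mul_comm]
    exact mul_le_mul_of_nonneg_right hb (by positivity)
  have hSm : MeasurableSet S :=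
    hAm.inter (isClosed_le continuous_const (continuous_polyFun q).abs).measurableSet
  refine ⟨S, inter_subset_left, hSm, ?_, fun x hx => hx.2⟩
  have h1 : volume.real A ≤ volume.real S + volume.real (A \ S) := by
    rw [← measureReal_inter_add_sdiff hSm hAfin]
    gcongr
    · exact measure_ne_top_of_subset inter_subset_left hAfin
    · exact inter_subset_right
  linarith

end Remez

/-! ### Splines and cells -/

section Cells

variable {d p : ℕ}

lemma KnotVector.le_of_le (Ξ : KnotVector p) {i j : ℕ} (hij : i ≤ j) (hj : j ≤ Ξ.n + p) :
    Ξ.ξ i ≤ Ξ.ξ j := by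
  induction j, hij using Nat.le_induction with
  | base => exact le_rfl
  | succ k hik ih => exact (ih (by omega)).trans (Ξ.mono k (by omega))

/-- Induction along the Cox–de Boor recursion: on an open knot span a B-spline of degree 0 is
constant, and each step multiplies by affine functions. The index bounds keep all compared knots in
the range where the sequence is monotone; the convention 0/0 = 0 is that of the inverse in ℝ. -/
lemma exists_polynomial_bspline (Ξ : KnotVector p) {j : ℕ} (hj : j < Ξ.n + p) (q : ℕ) :
    ∀ i, i + q < Ξ.n + p → ∃ P : Polynomial ℝ, P.natDegree ≤ q ∧
      ∀ x ∈ Ioo (Ξ.ξ j) (Ξ.ξ (j + 1)), bspline Ξ.ξ q i x = P.eval x := by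
  induction q with
  | zero =>
    intro i hi
    rcases lt_trichotomy i j with h | h | h
    · refine ⟨0, by simp, fun x hx => ?_⟩
      have h1 : Ξ.ξ (i + 1) ≤ Ξ.ξ j := Ξ.le_of_le h (by omega)
      have h2 : ¬ (Ξ.ξ i ≤ x ∧ x < Ξ.ξ (i + 1)) := fun h3 => by linarith [hx.1, h3.2]
      simp [bspline, h2]
    · subst h
      refine ⟨1, by simp, fun x hx => ?_⟩
      simp [bspline, hx.1.le, hx.2]
    · refine ⟨0, by simp, fun x hx => ?_⟩
      have h1 : Ξ.ξ (j + 1) ≤ Ξ.ξ i := Ξ.le_of_le h (by omega)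
      have h2 : ¬ (Ξ.ξ i ≤ x ∧ x < Ξ.ξ (i + 1)) := fun h3 => by linarith [hx.2, h3.1]
      simp [bspline, h2]
  | succ q ih =>
    intro i hi
    obtain ⟨P, hP, hPx⟩ := ih i (by omega)
    obtain ⟨P', hP', hPx'⟩ := ih (i + 1) (by omega)
    refine ⟨Polynomial.C (Ξ.ξ (i + q + 1) - Ξ.ξ i)⁻¹ *
        ((Polynomial.X - Polynomial.C (Ξ.ξ i)) * P) +
      Polynomial.C (Ξ.ξ (i + q + 2) - Ξ.ξ (i + 1))⁻¹ *
        ((Polynomial.C (Ξ.ξ (i + q + 2)) - Polynomial.X) * P'), ?_, fun x hx => ?_⟩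
    · refine (Polynomial.natDegree_add_le _ _).trans (max_le ?_ ?_)
      · refine (Polynomial.natDegree_C_mul_le _ _).trans (Polynomial.natDegree_mul_le.trans ?_)
        rw [Polynomial.natDegree_X_sub_C]; omega
      · refine (Polynomial.natDegree_C_mul_le _ _).trans (Polynomial.natDegree_mul_le.trans ?_)
        have : (Polynomial.C (Ξ.ξ (i + q + 2)) - Polynomial.X).natDegree ≤ 1 :=
          (Polynomial.natDegree_sub_le _ _).trans (by simp)
        omega
    · simp only [bspline, hPx x hx, hPx' x hx, Polynomial.eval_add, Polynomial.eval_mul,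
        Polynomial.eval_C, Polynomial.eval_sub, Polynomial.eval_X]
      ring

/-- A product of d univariate polynomials of degree at most p. The total degree is recorded because
the Remez inequality is stated in terms of it. -/
lemma exists_polyFun_eqOn_cell {Ξ : Fin d → KnotVector p} {j : Fin d → ℕ} (hj : IsCellIndex Ξ j)
    {s : E d → ℝ} (hs : s ∈ splineSpace Ξ) :
    ∃ q ∈ MvPolynomial.restrictTotalDegree (Fin d) ℝ (d * p), EqOn s (polyFun q) (cell Ξ j) := by
  induction hs using Submodule.span_induction with
  | mem s hs =>
    obtain ⟨i, hi, rfl⟩ := hs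
    choose P hP hPx using fun l => exists_polynomial_bspline (Ξ l) (j := j l)
      (by have := (hj l).1; omega) p (i l) (by have := hi l; omega)
    refine ⟨∏ l, Polynomial.aeval (MvPolynomial.X l) (P l), ?_, fun x hx => ?_⟩
    · rw [MvPolynomial.mem_restrictTotalDegree]
      refine (MvPolynomial.totalDegree_finsetProd _ _).trans
        ((Finset.sum_le_card_nsmul _ _ p fun l _ => ?_).trans (by simp))
      rw [Polynomial.aeval_eq_sum_range]
      refine MvPolynomial.totalDegree_finsetSum_le fun k hk => ?_
      refine (MvPolynomial.totalDegree_smul_le _ _).trans ?_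
      rw [MvPolynomial.totalDegree_X_pow]
      have := hP l
      have := Finset.mem_range.mp hk
      omega
    · simp only [tensorBspline, polyFun, map_prod]
      refine Finset.prod_congr rfl fun l _ => ?_
      rw [hPx l (x l) (hx l), Polynomial.aeval_def, Polynomial.hom_eval₂, Polynomial.eval,
        MvPolynomial.eval_X]
      congr 1
      ext; simp
  | zero => exact ⟨0, Submodule.zero_mem _, fun x _ => by simp [polyFun]⟩
  | add f g _ _ hf hg =>
    obtain ⟨q, hq, hfq⟩ := hf
    obtain ⟨q', hq', hgq⟩ := hg
    exact ⟨q + q', Submodule.add_mem _ hq hq', fun x hx => by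
      simp [polyFun, hfq hx, hgq hx]⟩
  | smul a f _ hf =>
    obtain ⟨q, hq, hfq⟩ := hf
    exact ⟨a • q, Submodule.smul_mem _ a hq, fun x hx => by simp [polyFun, hfq hx]⟩

lemma isOpen_cell (Ξ : Fin d → KnotVector p) (j : Fin d → ℕ) : IsOpen (cell Ξ j) := by
  simp only [cell, ofPred_forall]
  refine isOpen_iInter_of_finite fun l => ?_
  exact isOpen_Ioo.preimage (EuclideanSpace.proj l : E d →L[ℝ] ℝ).continuous

lemma isBounded_cube (d : ℕ) : Bornology.IsBounded (cube d) := by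
  have h1 : Bornology.IsBounded (Set.pi univ fun _ : Fin d => Ioo (0 : ℝ) 1) :=
    Bornology.IsBounded.pi fun _ => Metric.isBounded_Ioo 0 1
  refine ((PiLp.antilipschitzWith_ofLp 2 (fun _ : Fin d => ℝ)).isBounded_preimage h1).subset ?_
  intro x hx l _
  exact hx l

lemma IsCellIndex.cell_subset_cube {Ξ : Fin d → KnotVector p} {j : Fin d → ℕ}
    (hj : IsCellIndex Ξ j) : cell Ξ j ⊆ cube d := fun x hx l => by
  have h0 : (0 : ℝ) ≤ (Ξ l).ξ (j l) := by
    rw [← (Ξ l).first 0 (Nat.zero_le _)]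
    exact (Ξ l).le_of_le (Nat.zero_le _) (by have := (hj l).1; omega)
  have h1 : (Ξ l).ξ (j l + 1) ≤ 1 := by
    rw [← (Ξ l).last (Ξ l).n le_rfl (by omega)]
    exact (Ξ l).le_of_le (hj l).1 (by omega)
  exact ⟨h0.trans_lt (hx l).1, (hx l).2.trans_le h1⟩

lemma IsCellIndex.isBounded_cell {Ξ : Fin d → KnotVector p} {j : Fin d → ℕ}
    (hj : IsCellIndex Ξ j) : Bornology.IsBounded (cell Ξ j) :=
  (isBounded_cube d).subset hj.cell_subset_cube

lemma IsCellIndex.nonempty_cell {Ξ : Fin d → KnotVector p} {j : Fin d → ℕ}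
    (hj : IsCellIndex Ξ j) : (cell Ξ j).Nonempty :=
  ⟨WithLp.toLp 2 fun l => ((Ξ l).ξ (j l) + (Ξ l).ξ (j l + 1)) / 2, fun l => by
    have := (hj l).2
    constructor <;> simp only <;> linarith⟩

/-- The cell is open, so the edge length is not attained; every smaller t > 0 is, by two points
placed symmetrically about the midpoint of the edge. -/
lemma IsCellIndex.edge_le_diam {Ξ : Fin d → KnotVector p} {j : Fin d → ℕ}
    (hj : IsCellIndex Ξ j) (l : Fin d) :
    (Ξ l).ξ (j l + 1) - (Ξ l).ξ (j l) ≤ Metric.diam (cell Ξ j) := by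
  obtain ⟨c, hc⟩ := hj.nonempty_cell
  refine le_of_forall_lt_imp_le_of_dense fun t ht => ?_
  rcases le_or_gt t 0 with h0 | h0
  · exact h0.trans Metric.diam_nonneg
  set a := (Ξ l).ξ (j l)
  set b := (Ξ l).ξ (j l + 1)
  set m := (a + b) / 2 with hm
  set x : E d := WithLp.toLp 2 (Function.update c l (m - t / 2)) with hx
  set y : E d := WithLp.toLp 2 (Function.update c l (m + t / 2)) with hy
  have hxm : x ∈ cell Ξ j := fun k => by
    rcases eq_or_ne k l with rfl | hk
    · simp only [hx, Function.update_self]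
      constructor <;> simp only [hm, a, b] at * <;> linarith
    · simpa [hx, hk] using hc k
  have hym : y ∈ cell Ξ j := fun k => by
    rcases eq_or_ne k l with rfl | hk
    · simp only [hy, Function.update_self]
      constructor <;> simp only [hm, a, b] at * <;> linarith
    · simpa [hy, hk] using hc k
  have h1 : |(y - x) l| ≤ ‖y - x‖ := PiLp.norm_apply_le (y - x) l
  have h2 : (y - x) l = t := by simp [hx, hy]
  rw [h2, abs_of_pos h0, ← dist_eq_norm] at h1
  exact h1.trans (Metric.dist_le_diam_of_mem hj.isBounded_cell hym hxm)

lemma IsCellIndex.diam_pos {Ξ : Fin d → KnotVector p} {j : Fin d → ℕ}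
    (hj : IsCellIndex Ξ j) (hd : 0 < d) : 0 < Metric.diam (cell Ξ j) :=
  (sub_pos.mpr (hj ⟨0, hd⟩).2).trans_le (hj.edge_le_diam ⟨0, hd⟩)

/-- For `2 ≤ d`, shape regularity of a tensor-product mesh implies global quasi-uniformity. -/
lemma ShapeRegular.diam_le {σ : ℝ} (hσ : 0 < σ) (hd : 2 ≤ d) {Ξ : Fin d → KnotVector p}
    (hΞ : ShapeRegular σ Ξ) {j j' : Fin d → ℕ} (hj : IsCellIndex Ξ j) (hj' : IsCellIndex Ξ j') :
    Metric.diam (cell Ξ j) ≤ σ ^ 2 * Metric.diam (cell Ξ j') := by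
  let l₀ : Fin d := ⟨0, by omega⟩
  let l₁ : Fin d := ⟨1, by omega⟩
  have hl : l₁ ≠ l₀ := by simp [l₀, l₁]
  -- The tensor-product mesh contains a cell with edge `l₀` of the first cell and all other edges of
  -- the second. Shape regularity of this mixed cell compares the two; the second direction `l₁` is
  -- where d ≥ 2 is needed.
  set k := Function.update j' l₀ (j l₀) with hk
  have hkc : IsCellIndex Ξ k := fun l => by
    rcases eq_or_ne l l₀ with rfl | h
    · simpa [hk] using hj l₀
    · simpa [hk, h] using hj' l
  have h1 := hΞ j hj l₀
  have h2 := hkc.edge_le_diam l₀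
  have h3 := hΞ k hkc l₁
  have h4 := hj'.edge_le_diam l₁
  simp only [hk, Function.update_self, Function.update_of_ne hl] at h2 h3
  calc Metric.diam (cell Ξ j) ≤ σ * (σ * Metric.diam (cell Ξ j')) := by
        refine h1.trans (mul_le_mul_of_nonneg_left ?_ hσ.le)
        exact h2.trans (h3.trans (mul_le_mul_of_nonneg_left h4 hσ.le))
    _ = _ := by ring

lemma ShapeRegular.le_volume_cell {σ : ℝ} (hσ : 0 < σ) {Ξ : Fin d → KnotVector p}
    (hΞ : ShapeRegular σ Ξ) {j : Fin d → ℕ} (hj : IsCellIndex Ξ j) :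
    (Metric.diam (cell Ξ j) / σ) ^ d ≤ volume.real (cell Ξ j) := by
  have h1 : cell Ξ j = (WithLp.ofLp : E d → Fin d → ℝ) ⁻¹'
      (Set.pi univ fun l => Ioo ((Ξ l).ξ (j l)) ((Ξ l).ξ (j l + 1))) := by
    ext x; simp [cell]
  have h2 : volume (cell Ξ j) =
      ∏ l, ENNReal.ofReal ((Ξ l).ξ (j l + 1) - (Ξ l).ξ (j l)) := by
    rw [h1, (PiLp.volume_preserving_ofLp (Fin d)).measure_preimage
      (MeasurableSet.univ_pi fun l => measurableSet_Ioo).nullMeasurableSet, Real.volume_pi_Ioo]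
  rw [measureReal_def, h2, ENNReal.toReal_prod]
  have h3 : (Metric.diam (cell Ξ j) / σ) ^ d = ∏ _l : Fin d, Metric.diam (cell Ξ j) / σ := by
    rw [Finset.prod_const, Finset.card_univ, Fintype.card_fin]
  rw [h3]
  refine Finset.prod_le_prod (fun l _ => div_nonneg Metric.diam_nonneg hσ.le) fun l _ => ?_
  rw [ENNReal.toReal_ofReal (sub_nonneg.mpr (hj l).2.le), div_le_iff₀ hσ, mul_comm]
  exact hΞ j hj l

end Cells

/-! ### The outward normal field is measurable -/

section Normal

variable {d : ℕ}

/-- For w = ν' - ν with both vectors of length one, ⟪w, ν⟫ = -‖w‖²/2 and ⟪w, ν'⟫ = ‖w‖²/2. A short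
step from x along w therefore lands inside Ω by the first normal and outside by the second. -/
lemma IsOutwardNormal.unique {Ω : Set (E d)} {x ν ν' : E d} (h : IsOutwardNormal Ω x ν)
    (h' : IsOutwardNormal Ω x ν') : ν = ν' := by
  by_contra hne
  set w : E d := ν' - ν with hw
  have hw0 : 0 < ‖w‖ := norm_pos_iff.mpr (sub_ne_zero.mpr (Ne.symm hne))
  have hsq : ‖w‖ ^ 2 = 2 - 2 * ⟪ν, ν'⟫ := by
    rw [hw, norm_sub_sq_real, h.1, h'.1, real_inner_comm]; ring
  have h1 : ⟪w, ν⟫ = -(‖w‖ ^ 2 / 2) := by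
    rw [hsq, hw, inner_sub_left, real_inner_self_eq_norm_sq, h.1, real_inner_comm]; ring
  have h2 : ⟪w, ν'⟫ = ‖w‖ ^ 2 / 2 := by
    rw [hsq, hw, inner_sub_left, real_inner_self_eq_norm_sq, h'.1]; ring
  obtain ⟨r, hr, hb⟩ := h.2 (‖w‖ / 4) (by positivity)
  obtain ⟨r', hr', hb'⟩ := h'.2 (‖w‖ / 4) (by positivity)
  set t : ℝ := min r r' / (2 * ‖w‖) with ht
  have hm : 0 < min r r' := lt_min hr hr'
  have ht0 : 0 < t := by positivity
  have htw : t * ‖w‖ = min r r' / 2 := by rw [ht]; field_simp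
  have hnorm : ‖t • w‖ = min r r' / 2 := by rw [norm_smul, Real.norm_of_nonneg ht0.le, htw]
  have hdist : dist (x + t • w) x = min r r' / 2 := by rw [dist_eq_norm, add_sub_cancel_left, hnorm]
  have hpos : 0 < t * ‖w‖ ^ 2 := by positivity
  have hin : x + t • w ∈ Ω := by
    refine (hb (x + t • w) ?_).1 ?_
    · rw [Metric.mem_ball, hdist]; linarith [min_le_left r r']
    · rw [add_sub_cancel_left, inner_smul_left, h1, norm_smul, Real.norm_of_nonneg ht0.le]
      simp only [conj_trivial]
      nlinarith
  refine (hb' (x + t • w) ?_).2 ?_ hin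
  · rw [Metric.mem_ball, hdist]; linarith [min_le_right r r']
  · rw [add_sub_cancel_left, inner_smul_left, h2, norm_smul, Real.norm_of_nonneg ht0.le]
    simp only [conj_trivial]
    nlinarith

lemma IsOutwardNormal.outwardNormal_eq {Ω : Set (E d)} {x ν : E d} (h : IsOutwardNormal Ω x ν) :
    outwardNormal Ω x = ν := by
  have hex : ∃ ν, IsOutwardNormal Ω x ν := ⟨ν, h⟩
  rw [outwardNormal, dif_pos hex]
  exact hex.choose_spec.unique h

lemma norm_outwardNormal_le (Ω : Set (E d)) (x : E d) : ‖outwardNormal Ω x‖ ≤ 1 := by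
  unfold outwardNormal
  split_ifs with h
  · exact h.choose_spec.1.le
  · simp

/-- For fixed ε and r the condition is closed in (x, ν): each y excludes an open set, so even an
uncountable intersection over y is harmless and Ω may be arbitrary. Monotonicity in ε and r reduces
the quantifiers to the countable values 1/(n+1). -/
lemma measurableSet_isOutwardNormal (Ω : Set (E d)) :
    MeasurableSet {t : E d × E d | IsOutwardNormal Ω t.1 t.2} := by
  let A : ℝ → ℝ → Set (E d × E d) := fun ε r => {t | ∀ y ∈ Metric.ball t.1 r,
    (⟪y - t.1, t.2⟫ < -(ε * ‖y - t.1‖) → y ∈ Ω) ∧ (ε * ‖y - t.1‖ < ⟪y - t.1, t.2⟫ → y ∉ Ω)}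
  have hA : ∀ ε r, IsClosed (A ε r) := by
    intro ε r
    have h1 : A ε r = ⋂ y : E d, {t : E d × E d |
        (dist y t.1 < r ∧ ⟪y - t.1, t.2⟫ < -(ε * ‖y - t.1‖) ∧ y ∉ Ω)}ᶜ ∩
        {t : E d × E d | (dist y t.1 < r ∧ ε * ‖y - t.1‖ < ⟪y - t.1, t.2⟫ ∧ y ∈ Ω)}ᶜ := by
      ext t
      simp only [A, mem_ofPred_eq, Metric.mem_ball, mem_iInter, mem_inter_iff, mem_compl_iff]
      refine forall_congr' fun y => ?_
      tauto
    rw [h1]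
    have hc1 : ∀ y : E d, Continuous fun t : E d × E d => dist y t.1 := fun y => by fun_prop
    have hc2 : ∀ y : E d, Continuous fun t : E d × E d => ⟪y - t.1, t.2⟫ := fun y => by fun_prop
    have hc3 : ∀ y : E d, Continuous fun t : E d × E d => ε * ‖y - t.1‖ := fun y => by fun_prop
    refine isClosed_iInter fun y => IsClosed.inter ?_ ?_
    · exact ((isOpen_lt (hc1 y) continuous_const).inter
        ((isOpen_lt (hc2 y) (hc3 y).neg).inter isOpen_const)).isClosed_compl
    · exact ((isOpen_lt (hc1 y) continuous_const).inter
        ((isOpen_lt (hc3 y) (hc2 y)).inter isOpen_const)).isClosed_compl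
  have hanti : ∀ {ε ε' r r' : ℝ}, ε ≤ ε' → r' ≤ r → A ε r ⊆ A ε' r' := by
    intro ε ε' r r' hε hr t ht y hy
    have h1 := ht y (Metric.ball_subset_ball hr hy)
    have h2 : ε * ‖y - t.1‖ ≤ ε' * ‖y - t.1‖ := mul_le_mul_of_nonneg_right hε (norm_nonneg _)
    exact ⟨fun h => h1.1 (by linarith), fun h => h1.2 (by linarith)⟩
  have heq : {t : E d × E d | IsOutwardNormal Ω t.1 t.2} =
      {t | ‖t.2‖ = 1} ∩ ⋂ n : ℕ, ⋃ m : ℕ, A (1 / ((n : ℝ) + 1)) (1 / ((m : ℝ) + 1)) := by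
    ext t
    simp only [IsOutwardNormal, mem_inter_iff, mem_ofPred_eq, mem_iInter, mem_iUnion]
    refine and_congr_right fun _ => ⟨fun h n => ?_, fun h ε hε => ?_⟩
    · obtain ⟨r, hr, hb⟩ := h (1 / ((n : ℝ) + 1)) (by positivity)
      obtain ⟨m, hm⟩ := exists_nat_one_div_lt hr
      exact ⟨m, hanti le_rfl hm.le hb⟩
    · obtain ⟨n, hn⟩ := exists_nat_one_div_lt hε
      obtain ⟨m, hm⟩ := h n
      exact ⟨1 / ((m : ℝ) + 1), by positivity, hanti hn.le le_rfl hm⟩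
  rw [heq]
  refine MeasurableSet.inter ?_ ?_
  · exact (isClosed_eq continuous_snd.norm continuous_const).measurableSet
  · exact MeasurableSet.iInter fun n => MeasurableSet.iUnion fun m => (hA _ _).measurableSet

/-- By uniqueness the projection to the base point is injective on the Borel graph of the normal, so
by the Lusin–Souslin theorem it maps Borel subsets of the graph to Borel sets. -/
lemma measurable_outwardNormal (Ω : Set (E d)) : Measurable (outwardNormal Ω) := by
  set N : Set (E d × E d) := {t | IsOutwardNormal Ω t.1 t.2} with hN
  have hNm : MeasurableSet N := measurableSet_isOutwardNormal Ω
  have hinj : InjOn Prod.fst N := by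
    rintro ⟨x, ν⟩ h ⟨x', ν'⟩ h' hx
    obtain rfl : x = x' := hx
    exact Prod.ext rfl (IsOutwardNormal.unique h h')
  have himg : ∀ B : Set (E d), MeasurableSet B →
      MeasurableSet (Prod.fst '' (N ∩ Prod.snd ⁻¹' B)) := fun B hB =>
    (hNm.inter (measurable_snd hB)).image_of_measurable_injOn measurable_fst
      (hinj.mono inter_subset_left)
  intro B hB
  -- The second piece collects the points without a normal, where the field has its default value 0.
  have heq : outwardNormal Ω ⁻¹' B = Prod.fst '' (N ∩ Prod.snd ⁻¹' B) ∪
      ((Prod.fst '' (N ∩ Prod.snd ⁻¹' univ))ᶜ ∩ {_x | (0 : E d) ∈ B}) := by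
    ext x
    by_cases h : ∃ ν, IsOutwardNormal Ω x ν
    · obtain ⟨ν, hν⟩ := h
      have h1 : x ∈ Prod.fst '' (N ∩ Prod.snd ⁻¹' univ) := ⟨(x, ν), ⟨hν, mem_univ _⟩, rfl⟩
      have h2 : x ∈ Prod.fst '' (N ∩ Prod.snd ⁻¹' B) ↔ ν ∈ B := by
        constructor
        · rintro ⟨⟨x', ν'⟩, ⟨h3, h4⟩, rfl⟩
          rwa [hν.unique h3]
        · exact fun h3 => ⟨(x, ν), ⟨hν, h3⟩, rfl⟩
      rw [mem_preimage, hν.outwardNormal_eq, mem_union, h2]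
      simp only [mem_inter_iff, mem_compl_iff, h1, not_true, false_and, or_false]
    · have h1 : ∀ C : Set (E d), x ∉ Prod.fst '' (N ∩ Prod.snd ⁻¹' C) := by
        rintro C ⟨⟨x', ν'⟩, ⟨h3, _⟩, rfl⟩
        exact h ⟨ν', h3⟩
      rw [mem_preimage, outwardNormal, dif_neg h, mem_union]
      simp [h1 B, h1 univ, -preimage_univ]
  rw [heq]
  exact (himg B hB).union ((himg univ MeasurableSet.univ).compl.inter (MeasurableSet.const _))

end Normal

/-! ### The parametrization on one cell -/

section Chart

variable {d : ℕ}

/-- On the cell `Q` the map `F` is the restriction of the smooth map `Φ`, and it is bi-Lipschitz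
with constants `a` and `b` on the parametric domain. -/
structure IsCellChart (F Φ : E d → E d) (a b : ℝ) (Q : Set (E d)) : Prop where
  isOpen : IsOpen Q
  subset_cube : Q ⊆ cube d
  eqOn : EqOn F Φ Q
  contDiff : ContDiff ℝ 1 Φ
  pos : 0 < a
  lower : ∀ x ∈ cube d, ∀ y ∈ cube d, a * dist x y ≤ dist (F x) (F y)
  upper : ∀ x ∈ cube d, ∀ y ∈ cube d, dist (F x) (F y) ≤ b * dist x y

namespace IsCellChart

variable {F Φ : E d → E d} {a b : ℝ} {Q : Set (E d)}

lemma isBounded (h : IsCellChart F Φ a b Q) : Bornology.IsBounded Q :=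
  (isBounded_cube d).subset h.subset_cube

lemma injOn (h : IsCellChart F Φ a b Q) : InjOn F (cube d) := fun x hx y hy hxy => by
  have h1 := h.lower x hx y hy
  rw [hxy, dist_self] at h1
  exact dist_le_zero.mp (nonpos_of_mul_nonpos_right h1 h.pos)

lemma invFunOn_apply (h : IsCellChart F Φ a b Q) {x : E d} (hx : x ∈ cube d) :
    Function.invFunOn F (cube d) (F x) = x :=
  h.injOn.leftInvOn_invFunOn hx

lemma image_eq (h : IsCellChart F Φ a b Q) : F '' Q = Φ '' Q := image_congr h.eqOn

lemma continuousOn (h : IsCellChart F Φ a b Q) : ContinuousOn F Q :=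
  h.contDiff.continuous.continuousOn.congr h.eqOn

lemma measurableSet_image (h : IsCellChart F Φ a b Q) {S : Set (E d)} (hS : MeasurableSet S)
    (hSQ : S ⊆ Q) : MeasurableSet (F '' S) :=
  hS.image_of_continuousOn_injOn (h.continuousOn.mono hSQ)
    (h.injOn.mono (hSQ.trans h.subset_cube))

lemma norm_fderiv_le (h : IsCellChart F Φ a b Q) {x : E d} (hx : x ∈ Q) (hb : 0 ≤ b) :
    ‖fderiv ℝ Φ x‖ ≤ b := by
  have h1 : HasFDerivAt Φ (fderiv ℝ Φ x) x :=
    (h.contDiff.differentiable one_ne_zero x).hasFDerivAt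
  refine h1.le_of_lip' hb ?_
  filter_upwards [h.isOpen.mem_nhds hx] with y hy
  rw [← dist_eq_norm, ← dist_eq_norm, ← h.eqOn hy, ← h.eqOn hx]
  exact h.upper y (h.subset_cube hy) x (h.subset_cube hx)

/-- Difference quotients of F give the bound on the open cell, and continuity of the derivative of Φ
carries it to the closure. This makes the Jacobian invertible up to the boundary of the cell. -/
lemma lower_fderiv (h : IsCellChart F Φ a b Q) {x : E d} (hx : x ∈ closure Q) (v : E d) :
    a * ‖v‖ ≤ ‖fderiv ℝ Φ x v‖ := by
  have hcl : IsClosed {x | a * ‖v‖ ≤ ‖fderiv ℝ Φ x v‖} :=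
    isClosed_le continuous_const
      ((h.contDiff.continuous_fderiv one_ne_zero).clm_apply continuous_const).norm
  refine closure_minimal (fun y hy => ?_) hcl hx
  have h1 : HasFDerivAt Φ (fderiv ℝ Φ y) y :=
    (h.contDiff.differentiable one_ne_zero y).hasFDerivAt
  have h2 := (h1.hasLineDerivAt v).tendsto_slope_zero
  refine ge_of_tendsto h2.norm ?_
  have h3 : ∀ᶠ t in 𝓝[≠] (0 : ℝ), y + t • v ∈ Q := by
    refine Filter.Eventually.filter_mono nhdsWithin_le_nhds ?_
    have hc : Continuous fun t : ℝ => y + t • v := by fun_prop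
    exact (hc.tendsto 0).eventually (h.isOpen.mem_nhds (by simpa using hy))
  filter_upwards [h3, self_mem_nhdsWithin] with t ht ht0
  have h4 := h.lower _ (h.subset_cube ht) _ (h.subset_cube hy)
  rw [h.eqOn ht, h.eqOn hy, dist_eq_norm, dist_eq_norm, add_sub_cancel_left, norm_smul] at h4
  have h5 : 0 < ‖t‖ := norm_pos_iff.mpr ht0
  rw [norm_smul, norm_inv, le_inv_mul_iff₀ h5]
  linarith

lemma lower_closure (h : IsCellChart F Φ a b Q) {x y : E d} (hx : x ∈ closure Q)
    (hy : y ∈ closure Q) : a * dist x y ≤ dist (Φ x) (Φ y) := by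
  obtain ⟨u, hu, hux⟩ := mem_closure_iff_seq_limit.mp hx
  obtain ⟨v, hv, hvy⟩ := mem_closure_iff_seq_limit.mp hy
  have hc := h.contDiff.continuous
  refine le_of_tendsto_of_tendsto' ((hux.dist hvy).const_mul a)
    (((hc.tendsto x).comp hux).dist ((hc.tendsto y).comp hvy)) fun n => ?_
  have h2 := h.lower (u n) (h.subset_cube (hu n)) (v n) (h.subset_cube (hv n))
  rwa [h.eqOn (hu n), h.eqOn (hv n)] at h2

/-- The derivative of `Φ` at a point of the closed cell, as an equivalence. -/
lemma exists_equiv (h : IsCellChart F Φ a b Q) {x : E d} (hx : x ∈ closure Q) :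
    ∃ e : E d ≃L[ℝ] E d, (e : E d →L[ℝ] E d) = fderiv ℝ Φ x ∧
      ‖(e.symm : E d →L[ℝ] E d)‖ ≤ a⁻¹ := by
  have hinj : Function.Injective (fderiv ℝ Φ x : E d →ₗ[ℝ] E d) := by
    rw [← LinearMap.ker_eq_bot, LinearMap.ker_eq_bot']
    intro v hv
    have h1 := h.lower_fderiv hx v
    rw [show fderiv ℝ Φ x v = 0 from hv, norm_zero] at h1
    exact norm_le_zero_iff.mp (nonpos_of_mul_nonpos_right h1 h.pos)
  let e := (LinearEquiv.ofInjectiveEndo _ hinj).toContinuousLinearEquiv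
  have he : ∀ v, e v = fderiv ℝ Φ x v := fun v => rfl
  refine ⟨e, ContinuousLinearMap.ext he, ?_⟩
  refine ContinuousLinearMap.opNorm_le_bound _ (inv_nonneg.mpr h.pos.le) fun w => ?_
  have h1 := h.lower_fderiv hx (e.symm w)
  rw [← he, e.apply_symm_apply] at h1
  rw [inv_mul_eq_div, le_div_iff₀ h.pos, mul_comm]
  exact h1

/-- The inverse function theorem, applied to the smooth representative Φ. -/
lemma image_mem_nhds (h : IsCellChart F Φ a b Q) {x : E d} (hx : x ∈ Q) :
    F '' Q ∈ 𝓝 (F x) := by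
  obtain ⟨e, he, -⟩ := h.exists_equiv (subset_closure hx)
  have h1 : HasStrictFDerivAt Φ (e : E d →L[ℝ] E d) x := by
    rw [he]; exact h.contDiff.contDiffAt.hasStrictFDerivAt one_ne_zero
  rw [h.image_eq, h.eqOn hx, ← h1.map_nhds_eq_of_equiv]
  exact Filter.image_mem_map (h.isOpen.mem_nhds hx)

lemma isOpen_image (h : IsCellChart F Φ a b Q) : IsOpen (F '' Q) :=
  isOpen_iff_mem_nhds.mpr (by rintro _ ⟨x, hx, rfl⟩; exact h.image_mem_nhds hx)

lemma dist_invFunOn_le (h : IsCellChart F Φ a b Q) {x y : E d} (hx : x ∈ F '' cube d)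
    (hy : y ∈ F '' cube d) :
    dist (Function.invFunOn F (cube d) x) (Function.invFunOn F (cube d) y) ≤ a⁻¹ * dist x y := by
  obtain ⟨x, hx, rfl⟩ := hx
  obtain ⟨y, hy, rfl⟩ := hy
  rw [h.invFunOn_apply hx, h.invFunOn_apply hy, inv_mul_eq_div, le_div_iff₀ h.pos, mul_comm]
  exact h.lower x hx y hy

/-- The derivative of `s ∘ F⁻¹`, in terms of the preimage. -/
noncomputable def pushDeriv (Φ : E d → E d) (q : MvPolynomial (Fin d) ℝ) (x : E d) :
    E d →L[ℝ] ℝ :=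
  (fderiv ℝ (polyFun q) x).comp (fderiv ℝ Φ x).inverse

lemma norm_pushDeriv_le (h : IsCellChart F Φ a b Q) (q : MvPolynomial (Fin d) ℝ) {x : E d}
    (hx : x ∈ closure Q) : ‖pushDeriv Φ q x‖ ≤ a⁻¹ * ‖∇ (polyFun q) x‖ := by
  obtain ⟨e, he, hn⟩ := h.exists_equiv hx
  rw [pushDeriv, ← he, ContinuousLinearMap.inverse_equiv, norm_gradient_eq, mul_comm]
  exact (ContinuousLinearMap.opNorm_comp_le _ _).trans
    (mul_le_mul_of_nonneg_left hn (norm_nonneg _))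

lemma continuousAt_pushDeriv (h : IsCellChart F Φ a b Q) (q : MvPolynomial (Fin d) ℝ) {x : E d}
    (hx : x ∈ closure Q) : ContinuousAt (pushDeriv Φ q) x := by
  obtain ⟨e, he, -⟩ := h.exists_equiv hx
  have h1 : ContinuousAt (ContinuousLinearMap.inverse : (E d →L[ℝ] E d) → E d →L[ℝ] E d)
      (fderiv ℝ Φ x) := by
    rw [← he]; exact (contDiffAt_map_inverse (𝕜 := ℝ) (n := 0) e).continuousAt
  have h2 : ContinuousAt (fun y => (fderiv ℝ Φ y).inverse) x :=
    ContinuousAt.comp (f := fderiv ℝ Φ) h1 (h.contDiff.continuous_fderiv one_ne_zero).continuousAt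
  exact (((contDiff_polyFun q (n := 1)).continuous_fderiv one_ne_zero).continuousAt).clm_comp h2

variable {s : E d → ℝ} {q : MvPolynomial (Fin d) ℝ}

/-- Near F x the chosen inverse is a right inverse of Φ, and it is continuous there by the lower
Lipschitz bound; with an invertible Jacobian this yields its derivative, and the chain rule does the
rest. -/
lemma hasFDerivAt_push (h : IsCellChart F Φ a b Q) (hs : EqOn s (polyFun q) Q) {x : E d}
    (hx : x ∈ Q) :
    HasFDerivAt (fun y => s (Function.invFunOn F (cube d) y)) (pushDeriv Φ q x) (F x) := by
  set G := Function.invFunOn F (cube d) with hG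
  have hGx : G (F x) = x := h.invFunOn_apply (h.subset_cube hx)
  have hnh := h.image_mem_nhds hx
  have hGQ : ∀ y ∈ F '' Q, G y ∈ Q ∧ Φ (G y) = y := by
    rintro _ ⟨z, hz, rfl⟩
    rw [hG, h.invFunOn_apply (h.subset_cube hz)]
    exact ⟨hz, (h.eqOn hz).symm⟩
  have hcont : ContinuousAt G (F x) := by
    rw [ContinuousAt, tendsto_iff_dist_tendsto_zero]
    have h1 : Filter.Tendsto (fun y => a⁻¹ * dist y (F x)) (𝓝 (F x)) (𝓝 0) := by
      have hc : Continuous fun y => a⁻¹ * dist y (F x) := by fun_prop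
      simpa using hc.tendsto (F x)
    refine squeeze_zero' (Filter.Eventually.of_forall fun _ => dist_nonneg) ?_ h1
    filter_upwards [hnh] with y hy
    exact h.dist_invFunOn_le (image_mono h.subset_cube hy)
      (mem_image_of_mem _ (h.subset_cube hx))
  obtain ⟨e, he, -⟩ := h.exists_equiv (subset_closure hx)
  have hΦ : HasFDerivAt Φ (e : E d →L[ℝ] E d) (G (F x)) := by
    rw [he, hGx]; exact (h.contDiff.differentiable one_ne_zero x).hasFDerivAt
  have hGd : HasFDerivAt G (e.symm : E d →L[ℝ] E d) (F x) :=
    HasFDerivAt.of_local_left_inverse hcont hΦ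
      (Filter.mem_of_superset hnh fun y hy => (hGQ y hy).2)
  have hq : HasFDerivAt (polyFun q) (fderiv ℝ (polyFun q) x) (G (F x)) := by
    rw [hGx]
    exact ((contDiff_polyFun q (n := 1)).differentiable one_ne_zero x).hasFDerivAt
  have hcomp := hq.comp (F x) hGd
  rw [pushDeriv, ← he, ContinuousLinearMap.inverse_equiv]
  refine hcomp.congr_of_eventuallyEq ?_
  filter_upwards [hnh] with y hy
  exact hs (hGQ y hy).1

lemma gradient_push (h : IsCellChart F Φ a b Q) (hs : EqOn s (polyFun q) Q) {x : E d}
    (hx : x ∈ Q) :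
    ∇ (fun y => s (Function.invFunOn F (cube d) y)) (F x) =
      (InnerProductSpace.toDual ℝ (E d)).symm (pushDeriv Φ q x) := by
  rw [gradient, (h.hasFDerivAt_push hs hx).fderiv]

lemma norm_gradient_le (h : IsCellChart F Φ a b Q) (hs : EqOn s (polyFun q) Q) {x : E d}
    (hx : x ∈ Q) (hb : 0 ≤ b) :
    ‖∇ (polyFun q) x‖ ≤ b * ‖∇ (fun y => s (Function.invFunOn F (cube d) y)) (F x)‖ := by
  obtain ⟨e, he, -⟩ := h.exists_equiv (subset_closure hx)
  have h1 : fderiv ℝ (polyFun q) x = (pushDeriv Φ q x).comp (fderiv ℝ Φ x) := by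
    rw [pushDeriv, ← he, ContinuousLinearMap.inverse_equiv]
    ext v; simp
  rw [norm_gradient_eq, norm_gradient_eq, (h.hasFDerivAt_push hs hx).fderiv, h1, mul_comm]
  exact (ContinuousLinearMap.opNorm_comp_le _ _).trans
    (mul_le_mul_of_nonneg_left (h.norm_fderiv_le hx hb) (norm_nonneg _))

/-- The gradient of `s ∘ F⁻¹` has limits at the closure of the physical element. -/
lemma exists_tendsto_gradient (h : IsCellChart F Φ a b Q) (hs : EqOn s (polyFun q) Q) {x : E d}
    (hx : x ∈ closure (F '' Q)) :
    ∃ ξ ∈ closure Q, Filter.Tendsto (∇ (fun y => s (Function.invFunOn F (cube d) y)))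
      (𝓝[F '' Q] x) (𝓝 ((InnerProductSpace.toDual ℝ (E d)).symm (pushDeriv Φ q ξ))) := by
  have hcomp : IsCompact (Φ '' closure Q) :=
    h.isBounded.isCompact_closure.image h.contDiff.continuous
  have h1 : closure (F '' Q) ⊆ Φ '' closure Q := by
    rw [h.image_eq]
    exact closure_minimal (image_mono subset_closure) hcomp.isClosed
  obtain ⟨ξ, hξ, rfl⟩ := h1 hx
  refine ⟨ξ, hξ, ?_⟩
  set G := Function.invFunOn F (cube d) with hG
  have hGQ : ∀ y ∈ F '' Q, G y ∈ Q ∧ F (G y) = y := by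
    rintro _ ⟨z, hz, rfl⟩
    rw [hG, h.invFunOn_apply (h.subset_cube hz)]
    exact ⟨hz, rfl⟩
  -- The lower Lipschitz bound on the closed cell forces the preimages to converge; the limit of the
  -- gradient then follows from continuity of `pushDeriv` at ξ.
  have hGt : Filter.Tendsto G (𝓝[F '' Q] (Φ ξ)) (𝓝 ξ) := by
    rw [tendsto_iff_dist_tendsto_zero]
    have h2 : Filter.Tendsto (fun y => a⁻¹ * dist y (Φ ξ)) (𝓝[F '' Q] (Φ ξ)) (𝓝 0) := by
      have hc : Continuous fun y => a⁻¹ * dist y (Φ ξ) := by fun_prop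
      simpa using (hc.tendsto (Φ ξ)).mono_left nhdsWithin_le_nhds
    refine squeeze_zero' (Filter.Eventually.of_forall fun _ => dist_nonneg) ?_ h2
    filter_upwards [self_mem_nhdsWithin] with y hy
    have h3 := h.lower_closure (subset_closure (hGQ y hy).1) hξ
    rw [← h.eqOn (hGQ y hy).1, (hGQ y hy).2] at h3
    rw [inv_mul_eq_div, le_div_iff₀ h.pos, mul_comm]
    exact h3
  have h4 := ((InnerProductSpace.toDual ℝ (E d)).symm.continuous.continuousAt.tendsto.comp
    ((h.continuousAt_pushDeriv q hξ).tendsto)).comp hGt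
  refine h4.congr' ?_
  filter_upwards [self_mem_nhdsWithin] with y hy
  have h5 := h.gradient_push hs (hGQ y hy).1
  rw [(hGQ y hy).2] at h5
  rw [h5]; rfl

/-- F⁻¹ has Lipschitz constant 1/a, which scales d-dimensional Hausdorff measure by at most a^(-d),
and Lebesgue measure is a multiple of that measure. No Jacobian or measurability of `S` enters. -/
lemma volume_le_image (h : IsCellChart F Φ a b Q) {S : Set (E d)} (hS : S ⊆ cube d) :
    volume S ≤ ENNReal.ofReal (a⁻¹ ^ d) * volume (F '' S) := by
  set G := Function.invFunOn F (cube d) with hG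
  have hGS : G '' (F '' S) = S := by
    rw [image_image]
    calc (fun x => G (F x)) '' S = id '' S := image_congr fun x hx => h.invFunOn_apply (hS hx)
      _ = S := image_id S
  have hL : LipschitzOnWith (Real.toNNReal a⁻¹) G (F '' S) := by
    refine LipschitzOnWith.of_dist_le_mul fun x hx y hy => ?_
    rw [Real.coe_toNNReal _ (inv_nonneg.mpr h.pos.le)]
    exact h.dist_invFunOn_le (image_mono hS hx) (image_mono hS hy)
  have h1 := hL.hausdorffMeasure_image_le (d := (d : ℝ)) (Nat.cast_nonneg d)
  rw [hGS, ENNReal.rpow_natCast] at h1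
  rw [Measure.isAddLeftInvariant_eq_smul (volume : Measure (E d)) μH[d]]
  simp only [Measure.smul_apply, ENNReal.smul_def, smul_eq_mul]
  rw [mul_left_comm, ENNReal.ofReal_pow (inv_nonneg.mpr h.pos.le)]
  exact mul_le_mul_right h1 _

end IsCellChart

/-- The hypotheses on `F` give a chart on every cell of a mesh with a larger spline space. -/
lemma exists_isCellChart {p p₀ : ℕ} {Ξ₀ : Fin d → KnotVector p₀} {Ξ : Fin d → KnotVector p}
    {F : E d → E d} {a b : ℝ} (hF : IsSplineMap Ξ₀ F) (hle : splineSpace Ξ₀ ≤ splineSpace Ξ)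
    (ha : 0 < a) (hab : ∀ x ∈ cube d, ∀ y ∈ cube d,
      a * dist x y ≤ dist (F x) (F y) ∧ dist (F x) (F y) ≤ b * dist x y)
    {j : Fin d → ℕ} (hj : IsCellIndex Ξ j) : ∃ Φ, IsCellChart F Φ a b (cell Ξ j) := by
  have h1 : ∀ i, ∃ q : MvPolynomial (Fin d) ℝ, ∀ x ∈ cell Ξ j, F x i = polyFun q x := fun i => by
    obtain ⟨s, hs, hFs⟩ := hF i
    obtain ⟨q, -, hq⟩ := exists_polyFun_eqOn_cell hj (hle hs)
    exact ⟨q, fun x hx => by rw [hFs x (hj.cell_subset_cube hx), hq hx]⟩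
  choose q hq using h1
  refine ⟨fun x => WithLp.toLp 2 fun i => polyFun (q i) x, isOpen_cell Ξ j, hj.cell_subset_cube,
    fun x hx => ?_, ?_, ha, fun x hx y hy => (hab x hx y hy).1, fun x hx y hy => (hab x hx y hy).2⟩
  · ext i
    exact hq i x hx
  · exact contDiff_euclidean.mpr fun i => contDiff_polyFun (q i)

end Chart

/-! ### The `L²`-projection -/

section Projection

variable {d p : ℕ}

lemma integrableOn_polyFun {K : Set (E d)} (hK : Bornology.IsBounded K)
    (q : MvPolynomial (Fin d) ℝ) : IntegrableOn (polyFun q) K :=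
  ((continuous_polyFun q).continuousOn.integrableOn_compact hK.isCompact_closure).mono_set
    subset_closure

lemma polyFun_mul (q r : MvPolynomial (Fin d) ℝ) (x : E d) :
    polyFun (q * r) x = polyFun q x * polyFun r x := by simp [polyFun]

lemma polyFun_sub (q r : MvPolynomial (Fin d) ℝ) (x : E d) :
    polyFun (q - r) x = polyFun q x - polyFun r x := by simp [polyFun]

lemma polyFun_C (c : ℝ) (x : E d) : polyFun (MvPolynomial.C c) x = c := by simp [polyFun]

lemma integrableOn_mul_polyFun {K : Set (E d)} (hK : Bornology.IsBounded K) {v : E d → ℝ}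
    (hKm : MeasurableSet K) (hv : ContinuousOn v K) {M : ℝ} (hM : ∀ x ∈ K, |v x| ≤ M)
    (q : MvPolynomial (Fin d) ℝ) : IntegrableOn (fun x => v x * polyFun q x) K :=
  (integrableOn_polyFun hK q).bdd_mul (hv.aestronglyMeasurable hKm)
    ((ae_restrict_iff' hKm).mpr (Filter.Eventually.of_forall hM))

/-- The L² Gram form is injective into the dual, since a polynomial of zero norm vanishes on a set
of positive measure; equal finite dimensions make it surjective. Existence is what gives the choice
in `l2Projection` its meaning. -/
lemma exists_isL2Projection {K : Set (E d)} (hK : Bornology.IsBounded K) (hKm : MeasurableSet K)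
    (hK0 : volume K ≠ 0) {v : E d → ℝ} (hv : ContinuousOn v K) {M : ℝ}
    (hM : ∀ x ∈ K, |v x| ≤ M) : ∃ q, IsL2Projection p K v q := by
  let V := MvPolynomial.restrictDegree (Fin d) ℝ p
  have hint : ∀ q r : MvPolynomial (Fin d) ℝ,
      IntegrableOn (fun x => polyFun q x * polyFun r x) K := fun q r =>
    (integrableOn_polyFun hK (q * r)).congr_fun (fun x _ => polyFun_mul q r x) hKm
  have hvint := integrableOn_mul_polyFun hK hKm hv hM
  let T : V →ₗ[ℝ] V →ₗ[ℝ] ℝ := LinearMap.mk₂ ℝ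
    (fun q r => ∫ x in K, polyFun q.1 x * polyFun r.1 x)
    (fun q q' r => by
      rw [← integral_add (hint _ _) (hint _ _)]
      simp [polyFun, add_mul])
    (fun c q r => by
      rw [smul_eq_mul, ← integral_const_mul]
      simp [polyFun, mul_assoc])
    (fun q r r' => by
      rw [← integral_add (hint _ _) (hint _ _)]
      simp [polyFun, mul_add])
    (fun c q r => by
      rw [smul_eq_mul, ← integral_const_mul]
      simp [polyFun, mul_left_comm])
  let ℓ : V →ₗ[ℝ] ℝ :=
    { toFun := fun r => ∫ x in K, v x * polyFun r.1 x
      map_add' := fun r r' => by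
        rw [← integral_add (hvint _) (hvint _)]
        simp [polyFun, mul_add]
      map_smul' := fun c r => by
        rw [RingHom.id_apply, smul_eq_mul, ← integral_const_mul]
        simp [polyFun, mul_left_comm] }
  have hinj : Function.Injective T := by
    rw [← LinearMap.ker_eq_bot, LinearMap.ker_eq_bot']
    intro q hq
    have h1 : ∫ x in K, polyFun q.1 x * polyFun q.1 x = 0 := congrArg (fun L => L q) hq
    rw [integral_eq_zero_iff_of_nonneg (fun x => mul_self_nonneg _) (hint _ _)] at h1
    have h2 : volume (K ∩ {x | polyFun q.1 x = 0}) ≠ 0 := by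
      have h3 : ∀ᵐ x ∂volume.restrict K, x ∈ {x | polyFun q.1 x = 0} := by
        filter_upwards [h1] with x hx
        simpa using hx
      rw [inter_comm, ← Measure.restrict_apply' hKm, measure_eq_measure_of_null_sdiff
        (subset_univ _) (by rw [← compl_eq_univ_sdiff]; exact h3), Measure.restrict_apply_univ]
      exact hK0
    exact Subtype.ext (eq_zero_of_polyFun_eq_zero h2 fun x hx => hx.2)
  have hsurj : Function.Surjective T :=
    (LinearMap.injective_iff_surjective_of_finrank_eq_finrank
      (Subspace.dual_finrank_eq (K := ℝ) (V := V)).symm).mp hinj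
  obtain ⟨q, hq⟩ := hsurj ℓ
  refine ⟨q.1, q.2, fun r hr => ?_⟩
  have h1 : ∫ x in K, polyFun q.1 x * polyFun r x = ∫ x in K, v x * polyFun r x :=
    congrArg (fun L => L ⟨r, hr⟩) hq
  simp only [sub_mul]
  rw [integral_sub (hvint r) (hint _ _), h1, sub_self]

/-- Expand (v - c)² with r = q - c, itself an admissible test polynomial: r² ≤ (v - c)² - 2(v - q)r,
and the mixed term integrates to zero by orthogonality. -/
lemma IsL2Projection.integral_sq_le {K : Set (E d)} (hK : Bornology.IsBounded K)
    (hKm : MeasurableSet K) {v : E d → ℝ} (hv : ContinuousOn v K) {q : MvPolynomial (Fin d) ℝ}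
    (hq : IsL2Projection p K v q) {c D : ℝ} (hD : ∀ x ∈ K, |v x - c| ≤ D) :
    ∫ x in K, (polyFun q x - c) ^ 2 ≤ D ^ 2 * volume.real K := by
  have hM : ∀ x ∈ K, |v x| ≤ D + |c| := fun x hx => by
    have := abs_sub_abs_le_abs_sub (v x) c
    linarith [hD x hx]
  set r := q - MvPolynomial.C c with hr
  have hrx : ∀ x : E d, polyFun r x = polyFun q x - c := fun x => by rw [hr, polyFun_sub, polyFun_C]
  have hrd : r ∈ MvPolynomial.restrictDegree (Fin d) ℝ p := by
    refine Submodule.sub_mem _ hq.1 ?_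
    rw [← MvPolynomial.monomial_zero']
    exact (MvPolynomial.monomial_mem_restrictSupport ℝ).mpr (Or.inl fun i => Nat.zero_le _)
  have h0 := hq.2 r hrd
  have hfin : volume K ≠ ⊤ := hK.measure_lt_top.ne
  have hint : IntegrableOn (fun x => (v x - polyFun q x) * polyFun r x) K := by
    have h1 := (integrableOn_mul_polyFun hK hKm hv hM r).sub (integrableOn_polyFun hK (q * r))
    refine h1.congr_fun (fun x _ => ?_) hKm
    simp [polyFun_mul, sub_mul]
  have hsq : IntegrableOn (fun x => (polyFun q x - c) ^ 2) K :=
    (integrableOn_polyFun hK (r * r)).congr_fun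
      (fun x _ => by simp only [polyFun_mul, hrx, sq]) hKm
  have hconst : Integrable (fun _ : E d => D ^ 2) (volume.restrict K) := integrableOn_const hfin
  calc ∫ x in K, (polyFun q x - c) ^ 2
      ≤ ∫ x in K, (D ^ 2 - 2 * ((v x - polyFun q x) * polyFun r x)) := by
        refine setIntegral_mono_on hsq (hconst.sub (hint.const_mul 2)) hKm
          fun x hx => ?_
        have h1 : (v x - c) ^ 2 ≤ D ^ 2 := sq_le_sq' (abs_le.mp (hD x hx)).1 (abs_le.mp (hD x hx)).2
        rw [hrx]
        nlinarith [sq_nonneg (v x - polyFun q x)]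
    _ = D ^ 2 * volume.real K := by
        rw [integral_sub hconst (hint.const_mul 2), integral_const_mul, h0,
          setIntegral_const, smul_eq_mul, mul_zero, sub_zero, mul_comm]

end Projection

/-! ### Local estimates -/

section Estimates

variable {d p : ℕ} {F Φ : E d → E d} {a b : ℝ} {s : E d → ℝ} {q : MvPolynomial (Fin d) ℝ}

lemma norm_le_sum_abs (x : E d) : ‖x‖ ≤ ∑ i, |x i| := by
  rw [EuclideanSpace.norm_eq]
  refine Real.sqrt_le_iff.mpr ⟨Finset.sum_nonneg fun i _ => abs_nonneg _, ?_⟩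
  simp only [Real.norm_eq_abs]
  exact Finset.sum_sq_le_sq_sum_of_nonneg fun i _ => abs_nonneg _

/-- Comparison with a constant function. Neither measurability nor finiteness of the norm of `f` is
required, so physical gradients can be inserted directly. -/
lemma ofReal_mul_sqrt_le_eLpNorm {f : E d → E d} {S : Set (E d)} (hS : MeasurableSet S) {m V : ℝ}
    (hm : 0 ≤ m) (hV : ENNReal.ofReal V ≤ volume S) (h : ∀ x ∈ S, m ≤ ‖f x‖) :
    ENNReal.ofReal (m * √V) ≤ eLpNorm f 2 (volume.restrict S) := by
  have h1 : eLpNorm (fun _ : E d => m) 2 (volume.restrict S) ≤ eLpNorm f 2 (volume.restrict S) := by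
    refine eLpNorm_mono_ae ((ae_restrict_iff' hS).mpr (Filter.Eventually.of_forall fun x hx => ?_))
    rw [Real.norm_of_nonneg hm]; exact h x hx
  refine le_trans ?_ h1
  rw [eLpNorm_const' m two_ne_zero ENNReal.ofNat_ne_top, Measure.restrict_apply_univ,
    Real.enorm_of_nonneg hm, ENNReal.ofReal_mul hm, Real.sqrt_eq_rpow]
  gcongr
  rcases le_or_gt V 0 with h0 | h0
  · rcases h0.eq_or_lt with rfl | h0
    · simp
    · rw [← Real.sqrt_eq_rpow, Real.sqrt_eq_zero_of_nonpos h0.le]; simp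
  · rw [← ENNReal.ofReal_rpow_of_pos h0]
    simp only [ENNReal.toReal_ofNat]
    gcongr

/-- On a good cell the gradient of a spline is controlled everywhere near the cell by the physical
gradient on the part of the element in the trimmed domain. -/
lemma exists_gradient_bound (d p : ℕ) {a b σ θ : ℝ} (ha : 0 < a) (hb : 0 < b) (hσ : 0 < σ)
    (hθ : 0 < θ) : ∃ C > 0, ∀ (F Φ : E d → E d) (Ξ : Fin d → KnotVector p) (j : Fin d → ℕ),
      0 < Metric.diam (cell Ξ j) → IsCellIndex Ξ j → ShapeRegular σ Ξ →
      IsCellChart F Φ a b (cell Ξ j) →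
      ∀ s : E d → ℝ, ∀ q ∈ MvPolynomial.restrictTotalDegree (Fin d) ℝ (d * p),
      EqOn s (polyFun q) (cell Ξ j) → ∀ A ⊆ cell Ξ j, MeasurableSet A →
      θ * volume.real (cell Ξ j) ≤ volume.real A → ∀ z ∈ cell Ξ j,
      ∀ y ∈ Metric.closedBall z (Metric.diam (cell Ξ j)),
      ENNReal.ofReal (‖∇ (polyFun q) y‖ * √(Metric.diam (cell Ξ j) ^ d)) ≤
        ENNReal.ofReal C * eLpNorm (∇ (fun y => s (Function.invFunOn F (cube d) y))) 2
          (volume.restrict (F '' A)) := by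
  -- Each edge is at least H/σ, so the trimmed part has measure at least θ (H/σ)^d.
  set η : ℝ := θ / σ ^ d with hη
  have hη0 : 0 < η := by positivity
  obtain ⟨κ, hκ, hrem⟩ := exists_remez d (d * p) 1 η hη0
  -- κ/b is the loss in passing from ∂_i q at `y` to the physical gradient on F(S); the root comes
  -- from |F(S)| ≥ a^d (η/2) H^d.
  set k : ℝ := κ / b * √(a ^ d * (η / 2)) with hk
  have hk0 : 0 < k := by positivity
  refine ⟨(d + 1) * k⁻¹, by positivity, ?_⟩
  intro F Φ Ξ j hH hj hΞ hch s q hq hs A hA hAm hAv z hz y hy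
  set Q := cell Ξ j with hQ
  set H := Metric.diam Q with hHdef
  set v : E d → ℝ := fun y => s (Function.invFunOn F (cube d) y) with hv
  set N := eLpNorm (∇ v) 2 (volume.restrict (F '' A)) with hN
  have hQball : Q ⊆ Metric.closedBall z (1 * H) := fun x hx => by
    rw [one_mul]; exact Metric.dist_le_diam_of_mem hj.isBounded_cell hx hz
  have hvol : η * H ^ d ≤ volume.real A := by
    refine le_trans ?_ hAv
    have := hΞ.le_volume_cell hσ hj
    rw [hη, div_mul_eq_mul_div, mul_div_assoc, ← div_pow]
    gcongr
  -- Remez is applied to each partial derivative separately, because the set `S` depends on it.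
  have hcomp : ∀ i, ENNReal.ofReal (|(∇ (polyFun q) y) i| * √(H ^ d)) ≤
      ENNReal.ofReal k⁻¹ * N := by
    intro i
    have hqi : MvPolynomial.pderiv i q ∈ MvPolynomial.restrictTotalDegree (Fin d) ℝ (d * p) := by
      have := pderiv_mem_restrictTotalDegree hq i
      rw [MvPolynomial.mem_restrictTotalDegree] at this ⊢
      omega
    obtain ⟨S, hSA, hSm, hSv, hSx⟩ := hrem _ hqi z H hH y (by rwa [one_mul]) A (hA.trans hQball)
      hAm hvol
    set m : ℝ := κ / b * |(∇ (polyFun q) y) i| with hm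
    have hlow : ∀ w ∈ F '' S, m ≤ ‖∇ v w‖ := by
      rintro _ ⟨x, hx, rfl⟩
      have h1 := hSx x hx
      have h2 := hch.norm_gradient_le hs (hA (hSA hx)) hb.le
      have h3 : |(∇ (polyFun q) x) i| ≤ ‖∇ (polyFun q) x‖ :=
        PiLp.norm_apply_le (∇ (polyFun q) x) i
      rw [gradient_polyFun_apply] at h3
      have h4 : κ * |(∇ (polyFun q) y) i| ≤ b * ‖∇ v (F x)‖ := by
        rw [gradient_polyFun_apply]
        refine le_trans ?_ (h1.trans (h3.trans h2))
        gcongr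
        have : 0 ≤ H * ‖∇ (polyFun (MvPolynomial.pderiv i q)) y‖ := by positivity
        linarith
      rw [hm, div_mul_eq_mul_div, div_le_iff₀ hb]
      linarith
    have hFS : MeasurableSet (F '' S) := hch.measurableSet_image hSm (hSA.trans hA)
    have hFSv : ENNReal.ofReal (a ^ d * (η / 2) * H ^ d) ≤ volume (F '' S) := by
      have h1 := hch.volume_le_image ((hSA.trans hA).trans hch.subset_cube)
      have hSfin : volume S ≠ ⊤ := (hj.isBounded_cell.subset (hSA.trans hA)).measure_lt_top.ne
      calc ENNReal.ofReal (a ^ d * (η / 2) * H ^ d)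
          ≤ ENNReal.ofReal (a ^ d) * volume S := by
            rw [mul_assoc, ENNReal.ofReal_mul (by positivity)]
            gcongr
            exact (ENNReal.ofReal_le_iff_le_toReal hSfin).mpr hSv
        _ ≤ ENNReal.ofReal (a ^ d) * (ENNReal.ofReal (a⁻¹ ^ d) * volume (F '' S)) := by gcongr
        _ = volume (F '' S) := by
            rw [← mul_assoc, ← ENNReal.ofReal_mul (by positivity), ← mul_pow,
              mul_inv_cancel₀ ha.ne', one_pow, ENNReal.ofReal_one, one_mul]
    have h5 := ofReal_mul_sqrt_le_eLpNorm (f := ∇ v) hFS (by positivity) hFSv hlow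
    have h6 : eLpNorm (∇ v) 2 (volume.restrict (F '' S)) ≤ N :=
      eLpNorm_mono_measure _ (Measure.restrict_mono (image_mono hSA) le_rfl)
    have h7 : |(∇ (polyFun q) y) i| * √(H ^ d) = k⁻¹ * (m * √(a ^ d * (η / 2) * H ^ d)) := by
      rw [Real.sqrt_mul (by positivity), hm,
        show κ / b * |(∇ (polyFun q) y) i| * (√(a ^ d * (η / 2)) * √(H ^ d)) =
          k * (|(∇ (polyFun q) y) i| * √(H ^ d)) by rw [hk]; ring, inv_mul_cancel_left₀ hk0.ne']
    rw [h7, ENNReal.ofReal_mul (by positivity)]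
    gcongr
    exact h5.trans h6
  calc ENNReal.ofReal (‖∇ (polyFun q) y‖ * √(H ^ d))
      ≤ ENNReal.ofReal (∑ i, |(∇ (polyFun q) y) i| * √(H ^ d)) := by
        rw [← Finset.sum_mul]
        gcongr
        exact norm_le_sum_abs _
    _ = ∑ i, ENNReal.ofReal (|(∇ (polyFun q) y) i| * √(H ^ d)) :=
        ENNReal.ofReal_sum_of_nonneg fun i _ => by positivity
    _ ≤ ∑ _i : Fin d, ENNReal.ofReal k⁻¹ * N := Finset.sum_le_sum fun i _ => hcomp i
    _ = d * (ENNReal.ofReal k⁻¹ * N) := by simp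
    _ ≤ ENNReal.ofReal ((d + 1) * k⁻¹) * N := by
        rw [ENNReal.ofReal_mul (by positivity), ← mul_assoc]
        gcongr
        rw [← ENNReal.ofReal_natCast]
        gcongr
        linarith

/-- The gradient of the `L²`-projection on an element of size `H` is controlled, at points at
distance comparable to `H`, by the oscillation of the projected function. -/
lemma exists_projection_bound (d p : ℕ) {η R : ℝ} (hη : 0 < η) (hR : 0 < R) :
    ∃ C > 0, ∀ (K : Set (E d)) (z : E d) (H : ℝ), 0 < H → MeasurableSet K →
      K ⊆ Metric.closedBall z (R * H) → η * H ^ d ≤ volume.real K →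
      ∀ v : E d → ℝ, ContinuousOn v K → ∀ c D : ℝ, 0 ≤ D → (∀ x ∈ K, |v x - c| ≤ D) →
      ∀ q, IsL2Projection p K v q → ∀ x ∈ Metric.closedBall z (R * H),
      H * ‖∇ (polyFun q) x‖ ≤ C * D := by
  obtain ⟨κ, hκ, hrem⟩ := exists_remez d (d * p) R η hη
  set β := volume.real (Metric.ball (0 : E d) 1) with hβ
  have hβ0 : 0 ≤ β := measureReal_nonneg
  -- Obtained by solving (κ g)² (η/2) H^d ≤ D² R^d β H^d for g², where g is the scaled gradient and
  -- β the volume of the unit ball.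
  set T : ℝ := R ^ d * β / (κ ^ 2 * (η / 2)) with hT
  have hT0 : 0 ≤ T := by positivity
  refine ⟨√T + 1, by positivity, ?_⟩
  intro K z H hH hKm hKz hKv v hv c D hD0 hD q hq x hx
  have hKb : Bornology.IsBounded K := Metric.isBounded_closedBall.subset hKz
  -- Subtracting the constant leaves the gradient unchanged and makes the mean square of the
  -- polynomial as small as the oscillation of `v`.
  set r := q - MvPolynomial.C c with hr
  have hrx : ∀ x : E d, polyFun r x = polyFun q x - c := fun x => by rw [hr, polyFun_sub, polyFun_C]
  have hrd : r ∈ MvPolynomial.restrictTotalDegree (Fin d) ℝ (d * p) :=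
    Submodule.sub_mem _ (restrictDegree_le_restrictTotalDegree p hq.1)
      (by simp [MvPolynomial.mem_restrictTotalDegree])
  have hgr : ∇ (polyFun r) x = ∇ (polyFun q) x := by
    have h1 : polyFun r = fun y => polyFun q y - c := funext hrx
    rw [gradient, gradient, h1, fderiv_sub_const]
  obtain ⟨S, hSK, hSm, hSv, hSx⟩ := hrem r hrd z H hH x hx K hKz hKm hKv
  set g := H * ‖∇ (polyFun q) x‖ with hg
  have hg0 : 0 ≤ g := by positivity
  have hint : IntegrableOn (fun y => (polyFun q y - c) ^ 2) K :=
    (integrableOn_polyFun hKb (r * r)).congr_fun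
      (fun x _ => by simp only [polyFun_mul, hrx, sq]) hKm
  have h1 : (κ * g) ^ 2 * (η / 2 * H ^ d) ≤ D ^ 2 * (R ^ d * β * H ^ d) :=
    calc (κ * g) ^ 2 * (η / 2 * H ^ d) ≤ (κ * g) ^ 2 * volume.real S := by gcongr
      _ = ∫ _y in S, (κ * g) ^ 2 := by rw [setIntegral_const, smul_eq_mul, mul_comm]
      _ ≤ ∫ y in S, (polyFun q y - c) ^ 2 := by
        refine setIntegral_mono_on (integrableOn_const (hKb.subset hSK).measure_lt_top.ne)
          (hint.mono_set hSK) hSm fun y hy => ?_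
        have h2 := hSx y hy
        rw [hgr, hrx, ← sq_abs (polyFun q y - c)] at *
        rw [hrx] at h2
        gcongr
        refine le_trans ?_ h2
        gcongr
        linarith [abs_nonneg (polyFun q x - c)]
      _ ≤ ∫ y in K, (polyFun q y - c) ^ 2 :=
        setIntegral_mono_set hint (Filter.Eventually.of_forall fun y => sq_nonneg _)
          hSK.eventuallyLE
      _ ≤ D ^ 2 * volume.real K := hq.integral_sq_le hKb hKm hv hD
      _ ≤ D ^ 2 * (R ^ d * β * H ^ d) := by
        gcongr
        refine (measureReal_mono hKz measure_closedBall_lt_top.ne).trans ?_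
        rw [Measure.addHaar_real_closedBall _ _ (by positivity), ← hβ, finrank_euclideanSpace_fin,
          mul_pow]
        exact le_of_eq (by ring)
  have h2 : g ^ 2 ≤ T * D ^ 2 := by
    have hHd : 0 < H ^ d := by positivity
    have h3 : (κ * g) ^ 2 * (η / 2) ≤ D ^ 2 * (R ^ d * β) := by
      refine le_of_mul_le_mul_right ?_ hHd
      linarith
    rw [hT, div_mul_eq_mul_div, le_div_iff₀ (by positivity)]
    linarith
  have h4 : g ≤ √T * D := by
    rw [← Real.sqrt_sq hD0, ← Real.sqrt_mul hT0]
    exact Real.le_sqrt_of_sq_le h2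
  linarith

end Estimates

/-! ### The stabilization operator -/

section Stabilization

variable {d p : ℕ} {F Φ : E d → E d} {a b : ℝ} {Q : Set (E d)} {s : E d → ℝ}
  {q : MvPolynomial (Fin d) ℝ}

lemma IsCellChart.extendFrom_gradient (h : IsCellChart F Φ a b Q) (hs : EqOn s (polyFun q) Q)
    {M : ℝ} (hM : ∀ y ∈ closure Q, ‖∇ (polyFun q) y‖ ≤ M) {x : E d} (hx : x ∈ closure (F '' Q)) :
    ‖extendFrom (F '' Q) (∇ fun y => s (Function.invFunOn F (cube d) y)) x‖ ≤ a⁻¹ * M := by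
  obtain ⟨ξ, hξ, ht⟩ := h.exists_tendsto_gradient hs hx
  rw [extendFrom_eq hx ht, LinearIsometryEquiv.norm_map]
  exact (h.norm_pushDeriv_le q hξ).trans
    (mul_le_mul_of_nonneg_left (hM ξ hξ) (inv_nonneg.mpr h.pos.le))

lemma IsCellChart.continuousOn_extendFrom_gradient (h : IsCellChart F Φ a b Q)
    (hs : EqOn s (polyFun q) Q) :
    ContinuousOn (extendFrom (F '' Q) (∇ fun y => s (Function.invFunOn F (cube d) y)))
      (closure (F '' Q)) :=
  continuousOn_extendFrom subset_rfl fun _ hx =>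
    let ⟨_, _, ht⟩ := h.exists_tendsto_gradient hs hx
    ⟨_, ht⟩

lemma abs_inner_outwardNormal_le (Ω : Set (E d)) (w x : E d) : |⟪w, outwardNormal Ω x⟫| ≤ ‖w‖ :=
  (abs_real_inner_le_norm _ _).trans
    (mul_le_of_le_one_right (norm_nonneg _) (norm_outwardNormal_le Ω x))

lemma IsCellChart.image_dist_le (h : IsCellChart F Φ a b Q) (hb : 0 ≤ b) {x y : E d} (hx : x ∈ Q)
    (hy : y ∈ Q) : dist (F x) (F y) ≤ b * Metric.diam Q :=
  (h.upper x (h.subset_cube hx) y (h.subset_cube hy)).trans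
    (mul_le_mul_of_nonneg_left (Metric.dist_le_diam_of_mem h.isBounded hx hy) hb)

lemma IsCellChart.isBounded_image (h : IsCellChart F Φ a b Q) (hb : 0 ≤ b) :
    Bornology.IsBounded (F '' Q) := by
  refine Metric.isBounded_iff.mpr ⟨b * Metric.diam Q, ?_⟩
  rintro _ ⟨x, hx, rfl⟩ _ ⟨y, hy, rfl⟩
  exact h.image_dist_le hb hx hy

lemma IsCellChart.hK_le (h : IsCellChart F Φ a b Q) (hb : 0 ≤ b) :
    hK F Q ≤ b * Metric.diam Q := by
  refine Metric.diam_le_of_forall_dist_le (mul_nonneg hb Metric.diam_nonneg) ?_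
  rintro _ ⟨x, hx, rfl⟩ _ ⟨y, hy, rfl⟩
  exact h.image_dist_le hb hx hy

/-- Points of the closure of an element are at distance comparable to the mesh size from the
elements in its neighborhood. -/
lemma dist_le_of_setDist_le {Q' : Set (E d)} {Φ' : E d → E d} (h : IsCellChart F Φ a b Q)
    (h' : IsCellChart F Φ' a b Q') (hb : 0 ≤ b) {c τ : ℝ} (hc : 0 ≤ c) (hQ : Q.Nonempty)
    (hH : 0 < Metric.diam Q') (hτ : Metric.diam Q ≤ τ * Metric.diam Q')
    (hdist : setDist (F '' Q) (F '' Q') ≤ c * hK F Q) {z x : E d} (hz : z ∈ Q')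
    (hx : x ∈ closure (F '' Q)) :
    dist x (F z) ≤ (b * τ * (1 + c) + 1 + b) * Metric.diam Q' := by
  have hne : (image2 dist (F '' Q) (F '' Q')).Nonempty :=
    (hQ.image F).image2 ⟨F z, mem_image_of_mem F hz⟩
  -- The infimum need not be attained; the slack diam Q' is the summand 1 in the constant.
  obtain ⟨t, ⟨k, hk, k', hk', rfl⟩, ht⟩ := exists_lt_of_csInf_lt hne
    (show setDist (F '' Q) (F '' Q') < c * hK F Q + Metric.diam Q' by linarith)
  have h1 : dist x k ≤ hK F Q := by
    have := Metric.dist_le_diam_of_mem (h.isBounded_image hb).closure hx (subset_closure hk)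
    rwa [Metric.diam_closure] at this
  have h2 : dist k' (F z) ≤ b * Metric.diam Q' := by
    obtain ⟨y, hy, rfl⟩ := hk'
    exact h'.image_dist_le hb hy hz
  have h3 : hK F Q ≤ b * (τ * Metric.diam Q') :=
    (h.hK_le hb).trans (mul_le_mul_of_nonneg_left hτ hb)
  have h4 := dist_triangle4 x k k' (F z)
  have h5 : (1 + c) * hK F Q ≤ (1 + c) * (b * (τ * Metric.diam Q')) :=
    mul_le_mul_of_nonneg_left h3 (by linarith)
  linarith

lemma IsCellChart.continuousOn_push (h : IsCellChart F Φ a b Q) (hs : EqOn s (polyFun q) Q) :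
    ContinuousOn (fun y => s (Function.invFunOn F (cube d) y)) (F '' Q) := by
  rintro _ ⟨x, hx, rfl⟩
  exact (h.hasFDerivAt_push hs hx).continuousAt.continuousWithinAt

/-- The mean value inequality is used in parametric coordinates, on a convex ball containing the
cell; the physical element need not be convex. -/
lemma IsCellChart.abs_push_sub_le (h : IsCellChart F Φ a b Q) (hs : EqOn s (polyFun q) Q)
    {M : ℝ} {z : E d} (hz : z ∈ Q)
    (hM : ∀ y ∈ Metric.closedBall z (Metric.diam Q), ‖∇ (polyFun q) y‖ ≤ M) {x : E d}
    (hx : x ∈ F '' Q) :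
    |s (Function.invFunOn F (cube d) x) - polyFun q z| ≤ M * Metric.diam Q := by
  obtain ⟨x, hx, rfl⟩ := hx
  have hd := Metric.dist_le_diam_of_mem h.isBounded hx hz
  have hM0 : 0 ≤ M := (norm_nonneg _).trans
    (hM z (Metric.mem_closedBall_self Metric.diam_nonneg))
  rw [h.invFunOn_apply (h.subset_cube hx), hs hx, ← Real.norm_eq_abs]
  refine ((convex_closedBall z (Metric.diam Q)).norm_image_sub_le_of_norm_fderiv_le
    (f := polyFun q) (𝕜 := ℝ)
    (fun y _ => (contDiff_polyFun q (n := 1)).differentiable one_ne_zero y)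
    (fun y hy => by rw [← norm_gradient_eq]; exact hM y hy)
    (Metric.mem_closedBall_self Metric.diam_nonneg) hd).trans ?_
  rw [← dist_eq_norm]
  exact mul_le_mul_of_nonneg_left hd hM0

/-- The weight √h and the root of the surface measure bound c h^(d-1) combine to √c h^(d/2), the
scaling of a volume integral. -/
lemma memLp_and_eLpNorm_le {μ : Measure (E d)} {Γ : Set (E d)} (hΓ : MeasurableSet Γ) (hd : 1 ≤ d)
    {c h B : ℝ} (hc : 0 ≤ c) (hh : 0 ≤ h) (hμ : μ Γ ≤ ENNReal.ofReal (c * h ^ (d - 1)))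
    {f : E d → ℝ} (hf : AEStronglyMeasurable f (μ.restrict Γ))
    (hB : ∀ x ∈ Γ, |f x| ≤ B) :
    MemLp f 2 (μ.restrict Γ) ∧
      eLpNorm (fun x => √h * f x) 2 (μ.restrict Γ) ≤ ENNReal.ofReal (√c * √(h ^ d) * B) := by
  have hfin : IsFiniteMeasure (μ.restrict Γ) :=
    ⟨by rw [Measure.restrict_apply_univ]; exact hμ.trans_lt ENNReal.ofReal_lt_top⟩
  refine ⟨MemLp.of_bound hf B ((ae_restrict_iff' hΓ).mpr (Filter.Eventually.of_forall hB)), ?_⟩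
  have h1 : ∀ᵐ x ∂μ.restrict Γ, ‖√h * f x‖ ≤ √h * B := by
    refine (ae_restrict_iff' hΓ).mpr (Filter.Eventually.of_forall fun x hx => ?_)
    rw [norm_mul, Real.norm_of_nonneg (Real.sqrt_nonneg h)]
    exact mul_le_mul_of_nonneg_left (hB x hx) (Real.sqrt_nonneg h)
  refine (eLpNorm_le_of_ae_bound h1).trans ?_
  rw [Measure.restrict_apply_univ]
  have h2 : (μ Γ) ^ (2 : ℝ≥0∞).toReal⁻¹ ≤ ENNReal.ofReal √(c * h ^ (d - 1)) := by
    rw [Real.sqrt_eq_rpow, ← ENNReal.ofReal_rpow_of_nonneg (by positivity) (by norm_num)]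
    simp only [ENNReal.toReal_ofNat, one_div]
    gcongr
  refine (mul_le_mul_left h2 _).trans ?_
  rw [← ENNReal.ofReal_mul (Real.sqrt_nonneg _)]
  refine le_of_eq (congrArg _ ?_)
  obtain ⟨n, rfl⟩ : ∃ n, d = n + 1 := ⟨d - 1, by omega⟩
  rw [Nat.add_sub_cancel, pow_succ, Real.sqrt_mul hc, Real.sqrt_mul (by positivity)]
  ring

lemma paramDomain_inter (h : IsCellChart F Φ a b Q) (Ω₁ : Set (E d)) :
    paramDomain F (trimmedDomain F Ω₁) ∩ Q = Q ∩ F ⁻¹' (closure Ω₁)ᶜ := by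
  ext x
  simp only [paramDomain, trimmedDomain, mem_inter_iff, mem_preimage, mem_sdiff, mem_compl_iff]
  exact ⟨fun hx => ⟨hx.2, hx.1.2.2⟩, fun hx => ⟨⟨h.subset_cube hx.1,
    mem_image_of_mem F (h.subset_cube hx.1), hx.2⟩, hx.1⟩⟩

lemma measurableSet_paramDomain_inter (h : IsCellChart F Φ a b Q) (Ω₁ : Set (E d)) :
    MeasurableSet (paramDomain F (trimmedDomain F Ω₁) ∩ Q) := by
  rw [paramDomain_inter h]
  exact (h.continuousOn.isOpen_inter_preimage h.isOpen isClosed_closure.isOpen_compl).measurableSet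

/-- Splines that agree on the trimmed part of a good element agree on all of it. -/
lemma eqOn_of_eqOn_trimmed (h : IsCellChart F Φ a b Q) {t : E d → ℝ}
    {r : MvPolynomial (Fin d) ℝ} (hs : EqOn s (polyFun q) Q) (ht : EqOn t (polyFun r) Q)
    {Ω : Set (E d)} (hvol : volume (paramDomain F Ω ∩ Q) ≠ 0)
    (hst : EqOn (fun y => s (Function.invFunOn F (cube d) y))
      (fun y => t (Function.invFunOn F (cube d) y)) Ω) :
    EqOn s t Q := by
  have h0 : q - r = 0 := eq_zero_of_polyFun_eq_zero hvol fun x hx => by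
    have h1 := hst hx.1.2
    simp only [h.invFunOn_apply (h.subset_cube hx.2)] at h1
    rw [polyFun_sub, ← hs hx.2, ← ht hx.2, h1, sub_self]
  rw [sub_eq_zero] at h0
  intro x hx
  rw [hs hx, ht hx, h0]

lemma extendFrom_congr {A : Set (E d)} {f g : E d → E d} (h : EqOn f g A) {x y : E d}
    (hx : x ∈ closure A) (hf : Filter.Tendsto f (𝓝[A] x) (𝓝 y)) :
    extendFrom A f x = extendFrom A g x := by
  rw [extendFrom_eq hx hf, extendFrom_eq hx (hf.congr' (h.eventuallyEq_nhdsWithin))]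

/-- The two defining predicates are equal, so the choice operator returns the same polynomial;
uniqueness of the projection is not needed. -/
lemma l2Projection_congr {K : Set (E d)} (hK : MeasurableSet K) {v w : E d → ℝ} (h : EqOn v w K) :
    l2Projection p K v = l2Projection p K w := by
  have h1 : IsL2Projection p K v = IsL2Projection p K w := by
    ext q
    refine and_congr_right fun _ => forall₂_congr fun r _ => ?_
    rw [setIntegral_congr_fun hK fun x hx => by rw [h hx]]
  rw [l2Projection, l2Projection, h1]

end Stabilization

end TrimmedIGA

/-! ### The uniform bound for the stabilization operator -/

open TrimmedIGA in
theorem mainTheorem3 (d : ℕ) (hd : 2 ≤ d) (p p₀ : ℕ) (hp : 1 ≤ p) (hp₀ : 1 ≤ p₀)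
    (Ξ₀ : Fin d → TrimmedIGA.KnotVector p₀) (F : TrimmedIGA.E d → TrimmedIGA.E d)
    (hF : TrimmedIGA.IsSplineMap Ξ₀ F)
    (hbi : TrimmedIGA.IsBiLipschitzOn F (TrimmedIGA.cube d))
    (σ θ cN cΓ : ℝ) (hσ : 0 < σ) (hθ : 0 < θ) (hθ' : θ ≤ 1) (hcN : 0 < cN) (hcΓ : 0 < cΓ) :
    ∃ C : ℝ, 0 < C ∧
      ∀ Ξ : Fin d → TrimmedIGA.KnotVector p,
        TrimmedIGA.splineSpace Ξ₀ ≤ TrimmedIGA.splineSpace Ξ →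
        TrimmedIGA.ShapeRegular σ Ξ →
      ∀ Ω₁ Ω : Set (TrimmedIGA.E d), IsOpen Ω₁ → Bornology.IsBounded Ω₁ →
        Ω = TrimmedIGA.trimmedDomain F Ω₁ → TrimmedIGA.HasLipschitzBoundary Ω →
      ∀ ΓD : Set (TrimmedIGA.E d), ΓD ⊆ frontier Ω → MeasurableSet ΓD →
        (∀ Q ∈ TrimmedIGA.activeMesh F Ξ Ω,
          TrimmedIGA.surfaceMeasure d (TrimmedIGA.boundaryPart F ΓD Q)
            ≤ ENNReal.ofReal (cΓ * TrimmedIGA.hK F Q ^ (d - 1))) →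
      ∀ nb : Set (TrimmedIGA.E d) → Set (TrimmedIGA.E d),
        (∀ Q ∈ TrimmedIGA.activeMesh F Ξ Ω, ¬ TrimmedIGA.IsGood θ F Ω Q →
          nb Q ∈ TrimmedIGA.goodNeighbors θ cN F Ξ Ω Q) →
      ∀ Q ∈ TrimmedIGA.cutMesh F Ξ Ω Ω₁,
        -- `R_K(v)` depends only on the restriction of `v` to the trimmed domain
        (∀ v ∈ TrimmedIGA.physSpace F Ξ, ∀ w ∈ TrimmedIGA.physSpace F Ξ, Set.EqOn v w Ω →
          Set.EqOn (TrimmedIGA.stabilization p θ F Ω nb Q v)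
            (TrimmedIGA.stabilization p θ F Ω nb Q w) (TrimmedIGA.boundaryPart F ΓD Q)) ∧
        ∀ v ∈ TrimmedIGA.physSpace F Ξ,
          MemLp (TrimmedIGA.stabilization p θ F Ω nb Q v) 2
            ((TrimmedIGA.surfaceMeasure d).restrict (TrimmedIGA.boundaryPart F ΓD Q)) ∧
          eLpNorm (fun x => √(TrimmedIGA.hK F Q) * TrimmedIGA.stabilization p θ F Ω nb Q v x) 2
              ((TrimmedIGA.surfaceMeasure d).restrict (TrimmedIGA.boundaryPart F ΓD Q))
            ≤ ENNReal.ofReal C *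
              eLpNorm (∇ v) 2 (volume.restrict
                (Ω ∩ F '' TrimmedIGA.supportElement θ F Ω nb Q)) := by
  obtain ⟨a, b₀, ha, hab₀⟩ := hbi
  -- The given upper Lipschitz constant is not assumed positive.
  set b : ℝ := max b₀ 1 with hbdef
  have hb : 0 < b := lt_max_of_lt_right one_pos
  have hab : ∀ x ∈ cube d, ∀ y ∈ cube d,
      a * dist x y ≤ dist (F x) (F y) ∧ dist (F x) (F y) ≤ b * dist x y := fun x hx y hy =>
    ⟨(hab₀ x hx y hy).1, (hab₀ x hx y hy).2.trans
      (mul_le_mul_of_nonneg_right (le_max_left _ _) dist_nonneg)⟩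
  obtain ⟨Cg, hCg, hgrad⟩ := exists_gradient_bound d p ha hb hσ hθ
  -- The constant of `dist_le_of_setDist_le` for size ratio σ² and neighbor distance `cN`: the ball
  -- of radius R H about F(z) contains both the support element and the closure of a bad K.
  set R : ℝ := b * σ ^ 2 * (1 + cN) + 1 + b with hR
  have hR0 : 0 < R := by positivity
  -- |F(Q')| ≥ a^d |Q'| ≥ (a/σ)^d H^d.
  obtain ⟨Cp, hCp, hproj⟩ := exists_projection_bound d p (η := (a / σ) ^ d) (R := R)
    (by positivity) hR0
  -- The first summand serves good elements, the second bad ones.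
  set C' : ℝ := a⁻¹ + Cp with hC'
  have hC'0 : 0 < C' := by positivity
  refine ⟨√cΓ * √((b * σ ^ 2) ^ d) * C' * Cg, by positivity, ?_⟩
  intro Ξ hle hΞ Ω₁ Ω _ _ hΩ _ ΓD _ hΓDm hΓ nb hnb Q hQ
  have hQact : Q ∈ activeMesh F Ξ Ω := hQ.1
  obtain ⟨j, hj, hQj⟩ := hQact.1
  -- the support element
  obtain ⟨j', hj', hsup, hgood⟩ : ∃ j', IsCellIndex Ξ j' ∧
      supportElement θ F Ω nb Q = cell Ξ j' ∧ IsGood θ F Ω (cell Ξ j') := by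
    by_cases hg : IsGood θ F Ω Q
    · exact ⟨j, hj, by rw [supportElement, if_pos hg, hQj], hQj ▸ hg⟩
    · have h1 := hnb Q hQact hg
      obtain ⟨j', hj', hQj'⟩ := h1.1.1
      exact ⟨j', hj', by rw [supportElement, if_neg hg, hQj'], hQj' ▸ h1.2.2.2⟩
  rw [hsup]
  obtain ⟨Φ, hch⟩ := exists_isCellChart hF hle ha hab hj
  obtain ⟨Φ', hch'⟩ := exists_isCellChart hF hle ha hab hj'
  rw [← hQj] at hch
  set Q' := cell Ξ j' with hQ'
  set H := Metric.diam Q' with hH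
  have hH0 : 0 < H := hj'.diam_pos (by omega)
  have hdiam : Metric.diam Q ≤ σ ^ 2 * H := by rw [hQj]; exact hΞ.diam_le hσ hd hj hj'
  have hhK : hK F Q ≤ b * σ ^ 2 * H := by
    refine (hch.hK_le hb.le).trans ?_
    rw [mul_assoc]
    exact mul_le_mul_of_nonneg_left hdiam hb.le
  have hhK0 : 0 ≤ hK F Q := Metric.diam_nonneg
  have hvolQ' : (H / σ) ^ d ≤ volume.real Q' := hΞ.le_volume_cell hσ hj'
  have hvolQ'0 : 0 < volume.real Q' := lt_of_lt_of_le (by positivity) hvolQ'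
  set A := paramDomain F Ω ∩ Q' with hA
  have hAv : θ * volume.real Q' ≤ volume.real A := (le_div_iff₀ hvolQ'0).mp hgood
  have hAm : MeasurableSet A := by rw [hA, hΩ]; exact measurableSet_paramDomain_inter hch' Ω₁
  have hA0 : volume A ≠ 0 := fun h0 => by
    rw [measureReal_def, measureReal_def, h0, ENNReal.toReal_zero, ← measureReal_def] at hAv
    linarith [mul_pos hθ hvolQ'0]
  have hFA : F '' A ⊆ Ω ∩ F '' Q' := by
    rintro _ ⟨x, hx, rfl⟩
    exact ⟨hx.1.2, mem_image_of_mem F hx.2⟩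
  have hFQ'm : MeasurableSet (F '' Q') := hch'.isOpen_image.measurableSet
  obtain ⟨z, hz⟩ := hj'.nonempty_cell
  have hQQ' : IsGood θ F Ω Q → Q = Q' := fun hg => by rw [← hsup, supportElement, if_pos hg]
  have hnbQ' : ¬ IsGood θ F Ω Q → nb Q = Q' := fun hg => by rw [← hsup, supportElement, if_neg hg]
  have hΓm : MeasurableSet (boundaryPart F ΓD Q) := hΓDm.inter isClosed_closure.measurableSet
  constructor
  -- Agreement on Ω determines the spline on the good cell `Q'`, and in both cases R_K sees the
  -- function only on F(Q').
  · rintro _ ⟨s, hs, rfl⟩ _ ⟨t, ht, rfl⟩ hvw x hx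
    obtain ⟨q, -, hq⟩ := exists_polyFun_eqOn_cell hj' hs
    obtain ⟨r, -, hr⟩ := exists_polyFun_eqOn_cell hj' ht
    have hst : EqOn s t Q' := eqOn_of_eqOn_trimmed hch' hq hr hA0 hvw
    simp only [stabilization]
    split_ifs with hg
    · have hQe := hQQ' hg
      congr 1
      have hx2 : x ∈ closure (F '' Q') := by rw [← hQe]; exact hx.2
      obtain ⟨ξ, -, htend⟩ := hch'.exists_tendsto_gradient hq hx2
      rw [hQe]
      refine extendFrom_congr ?_ hx2 htend
      rintro _ ⟨y, hy, rfl⟩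
      rw [hch'.gradient_push hq hy,
        hch'.gradient_push (s := t) (fun u hu => (hst hu).symm.trans (hq hu)) hy]
    · rw [hnbQ' hg, l2Projection_congr hFQ'm]
      rintro _ ⟨y, hy, rfl⟩
      simp only [hch'.invFunOn_apply (hch'.subset_cube hy)]
      exact hst hy
  · rintro _ ⟨s, hs, rfl⟩
    obtain ⟨q, hqd, hq⟩ := exists_polyFun_eqOn_cell hj' hs
    set v : E d → ℝ := fun y => s (Function.invFunOn F (cube d) y) with hv
    -- pointwise bound and measurability
    have hbound : ∀ M, (∀ y ∈ Metric.closedBall z H, ‖∇ (polyFun q) y‖ ≤ M) →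
        ∀ x ∈ boundaryPart F ΓD Q, |stabilization p θ F Ω nb Q v x| ≤ C' * M := by
      intro M hM x hx
      have hM0 : 0 ≤ M := (norm_nonneg _).trans (hM z (Metric.mem_closedBall_self hH0.le))
      simp only [stabilization]
      split_ifs with hg
      · refine (abs_inner_outwardNormal_le _ _ _).trans ?_
        have hQe := hQQ' hg
        have hx2 : x ∈ closure (F '' Q') := by rw [← hQe]; exact hx.2
        have hcl : closure Q' ⊆ Metric.closedBall z H :=
          closure_minimal (fun y hy => Metric.dist_le_diam_of_mem hch'.isBounded hy hz)
            Metric.isClosed_closedBall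
        rw [hQe]
        refine (hch'.extendFrom_gradient hq (fun y hy => hM y (hcl hy)) hx2).trans ?_
        gcongr
        linarith
      · refine (abs_inner_outwardNormal_le _ _ _).trans ?_
        rw [hnbQ' hg]
        have hnbd := (hnb Q hQact hg).2.2.1
        rw [hnbQ' hg] at hnbd
        have hxd : x ∈ Metric.closedBall (F z) (R * H) :=
          dist_le_of_setDist_le hch hch' hb.le hcN.le (hQj ▸ hj.nonempty_cell) hH0 hdiam hnbd hz hx.2
        have hKsub : F '' Q' ⊆ Metric.closedBall (F z) (R * H) := by
          rintro _ ⟨y, hy, rfl⟩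
          refine (hch'.image_dist_le hb.le hy hz).trans ?_
          gcongr
          have : 0 ≤ b * σ ^ 2 * (1 + cN) := by positivity
          linarith
        have hKvol : (a / σ) ^ d * H ^ d ≤ volume.real (F '' Q') := by
          have h1 := hch'.volume_le_image hch'.subset_cube
          have hfin : volume (F '' Q') ≠ ⊤ := (hch'.isBounded_image hb.le).measure_lt_top.ne
          have h2 : volume.real Q' ≤ a⁻¹ ^ d * volume.real (F '' Q') := by
            rw [measureReal_def, measureReal_def, ← ENNReal.toReal_ofReal (r := a⁻¹ ^ d)
              (by positivity), ← ENNReal.toReal_mul]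
            exact ENNReal.toReal_mono (ENNReal.mul_ne_top ENNReal.ofReal_ne_top hfin) h1
          rw [inv_pow, inv_mul_eq_div, le_div_iff₀ (by positivity)] at h2
          refine le_trans ?_ h2
          calc (a / σ) ^ d * H ^ d = (H / σ) ^ d * a ^ d := by
                rw [← mul_pow, ← mul_pow]; congr 1; ring
            _ ≤ _ := by gcongr
        have hcont := hch'.continuousOn_push hq
        have hosc : ∀ x ∈ F '' Q', |v x - polyFun q z| ≤ M * H := fun x hx =>
          hch'.abs_push_sub_le hq hz hM hx
        have hex : ∃ P, IsL2Projection p (F '' Q') v P := by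
          refine exists_isL2Projection (hch'.isBounded_image hb.le) hFQ'm ?_ hcont
            (M := M * H + |polyFun q z|) fun x hx => ?_
          · exact (hch'.isOpen_image.measure_pos _ ⟨F z, mem_image_of_mem F hz⟩).ne'
          · have := abs_sub_abs_le_abs_sub (v x) (polyFun q z)
            linarith [hosc x hx]
        have h3 := hproj (F '' Q') (F z) H hH0 hFQ'm hKsub hKvol v hcont (polyFun q z) (M * H)
          (by positivity) hosc _ (Classical.epsilon_spec hex) x hxd
        have h4 : ‖∇ (polyFun (l2Projection p (F '' Q') v)) x‖ ≤ Cp * M := by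
          refine le_of_mul_le_mul_left ?_ hH0
          calc _ ≤ Cp * (M * H) := h3
            _ = _ := by ring
        refine h4.trans ?_
        gcongr
        have : 0 < a⁻¹ := by positivity
        linarith
    have hmeas : AEStronglyMeasurable (stabilization p θ F Ω nb Q v)
        ((surfaceMeasure d).restrict (boundaryPart F ΓD Q)) := by
      have hn := (measurable_outwardNormal Ω).aestronglyMeasurable
        (μ := (surfaceMeasure d).restrict (boundaryPart F ΓD Q))
      by_cases hg : IsGood θ F Ω Q
      · have h1 : stabilization p θ F Ω nb Q v =
            fun x => ⟪extendFrom (F '' Q) (∇ v) x, outwardNormal Ω x⟫ := by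
          ext x; simp only [stabilization, if_pos hg]
        rw [h1]
        refine AEStronglyMeasurable.inner ?_ hn
        rw [hQQ' hg]
        exact ((hch'.continuousOn_extendFrom_gradient hq).mono
          inter_subset_right).aestronglyMeasurable (hQQ' hg ▸ hΓm)
      · have h1 : stabilization p θ F Ω nb Q v =
            fun x => ⟪∇ (polyFun (l2Projection p (F '' nb Q) v)) x, outwardNormal Ω x⟫ := by
          ext x; simp only [stabilization, if_neg hg]
        rw [h1]
        exact (continuous_gradient_polyFun _).aestronglyMeasurable.inner hn
    have hcombine : ∀ M, (∀ y ∈ Metric.closedBall z H, ‖∇ (polyFun q) y‖ ≤ M) →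
        MemLp (stabilization p θ F Ω nb Q v) 2
            ((surfaceMeasure d).restrict (boundaryPart F ΓD Q)) ∧
          eLpNorm (fun x => √(hK F Q) * stabilization p θ F Ω nb Q v x) 2
              ((surfaceMeasure d).restrict (boundaryPart F ΓD Q)) ≤
            ENNReal.ofReal (√cΓ * √(hK F Q ^ d) * (C' * M)) := fun M hM =>
      memLp_and_eLpNorm_le hΓm (by omega) hcΓ.le hhK0 (hΓ Q hQact) hmeas (hbound M hM)
    -- A crude bound from compactness gives square integrability whether or not the norm on the
    -- right-hand side is finite.
    obtain ⟨M₀, hM₀⟩ := (isCompact_closedBall z H).bddAbove_image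
      (continuous_gradient_polyFun q).norm.continuousOn
    refine ⟨(hcombine M₀ fun y hy => hM₀ (mem_image_of_mem _ hy)).1, ?_⟩
    set N := eLpNorm (∇ v) 2 (volume.restrict (Ω ∩ F '' Q')) with hN
    -- If the right-hand norm is infinite the estimate is trivial, since the constant is positive;
    -- integrability of the gradient thus need not be proved.
    rcases eq_or_ne N ⊤ with hNtop | hNtop
    · rw [hNtop, ENNReal.mul_top (by rw [ne_eq, ENNReal.ofReal_eq_zero, not_le]; positivity)]
      exact le_top
    · have hHd : 0 < √(H ^ d) := by positivity
      have hM : ∀ y ∈ Metric.closedBall z H,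
          ‖∇ (polyFun q) y‖ ≤ Cg * N.toReal / √(H ^ d) := by
        intro y hy
        have h1 := hgrad F Φ' Ξ j' hH0 hj' hΞ hch' s q hqd hq A inter_subset_right hAm hAv z hz y hy
        have h2 : eLpNorm (∇ v) 2 (volume.restrict (F '' A)) ≤ N :=
          eLpNorm_mono_measure _ (Measure.restrict_mono hFA le_rfl)
        have h3 := h1.trans (mul_le_mul_right h2 _)
        rw [← ENNReal.ofReal_toReal hNtop, ← ENNReal.ofReal_mul hCg.le,
          ENNReal.ofReal_le_ofReal_iff (by positivity)] at h3
        rwa [le_div_iff₀ hHd]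
      refine (hcombine _ hM).2.trans ?_
      rw [← ENNReal.ofReal_toReal hNtop, ← ENNReal.ofReal_mul (by positivity)]
      rw [ENNReal.toReal_ofReal ENNReal.toReal_nonneg]
      refine ENNReal.ofReal_le_ofReal ?_
      -- Quasi-uniformity trades h_K for H, whose power then cancels the denominator of the gradient
      -- bound.
      have h4 : √(hK F Q ^ d) ≤ √((b * σ ^ 2) ^ d) * √(H ^ d) := by
        rw [← Real.sqrt_mul (by positivity), ← mul_pow]
        exact Real.sqrt_le_sqrt (pow_le_pow_left₀ hhK0 hhK d)
      calc √cΓ * √(hK F Q ^ d) * (C' * (Cg * N.toReal / √(H ^ d)))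
          ≤ √cΓ * (√((b * σ ^ 2) ^ d) * √(H ^ d)) * (C' * (Cg * N.toReal / √(H ^ d))) := by
            gcongr
        _ = √cΓ * √((b * σ ^ 2) ^ d) * C' * Cg * N.toReal := by
            field_simp
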